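/- Let $m\ge 1$, and let $\mathbb{R}_{0,m}$ be the Clifford algebra generated by $e_1,\dots,e_m$ with $e_je_k+e_ke_j=-2\delta_{jk}$, taken here with complex coefficients. For $\lambda\in\mathbb{C}$ let $U_\lambda$ be the Clifford-vector valued tempered distribution on $\mathbb{R}^m$ $$\langle U_\lambda,\varphi\rangle=\sigma_m\,\bigl\langle \mathrm{Fp}\,r_+^{\lambda+m-1},\ \Sigma^{(1)}[\varphi]\bigr\rangle,\qquad \Sigma^{(1)}[\varphi](r)=\frac1{\sigma_m}\int_{S^{m-1}}\omega\,\varphi(r\omega)\,dS(\omega),\qquad \sigma_m=\frac{2\pi^{m/2}}{\Gamma(m/2)},$$ where $\omega=\sum_j\omega_je_j$ and $\mathrm{Fp}$ denotes Hadamard's finite part. Let $\partial=\sum_j e_j\partial_{x_j}$ be the Dirac operator and put $$U^*_\lambda=\pi^{\frac{\lambda+m+1}{2}}\frac{U_\lambda}{\Gamma\left(\frac{\lambda+m+1}{2}\right)}\quad(\lambda\ne -m-2l-1),\qquad U^*_{-m-2l-1}=-\frac{\pi^{\frac m2-l}}{2^{2l+1}\Gamma\left(\frac m2+l+1\right)}\,\partial^{2l+1}\delta\qquad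 (l=0,1,2,\dots).$$ For $\beta\in\mathbb{C}$ with $\beta\neq-\frac{m+1}{2}-n$, $n=0,1,2,\dots$, put $$(-\Delta_m)^\beta H=-2^{2\beta}\,\frac{\Gamma\left(\frac{m+2\beta+1}{2}\right)}{\pi^{\frac{m-2\beta+1}{2}}}\;U^*_{-m-2\beta},$$ and let ${}^\beta\!\mathcal{L}[\,\cdot\,]=(-\Delta_m)^\beta H*[\,\cdot\,]$ be the corresponding convolution operator. Here the convolution $S*T$ of Clifford-valued tempered distributions is the usual $\mathcal{S}'$-convolution: $S$ and $T$ are convolvable with $S*T=R$ if for all Schwartz functions $\varphi,\psi$ and all $x$ the function $y\mapsto (S*\varphi)(y)\,(T*\psi)(x-y)$ is integrable and $(S*\varphi)*(T*\psi)=(R*\varphi)*\psi$. Then for every $\beta\in\mathbb{C}\setminus\{\pm(\frac{m+1}{2}+n):n=0,1,2,\dots\}$ the distributions $(-\Delta_m)^\beta H$ and $(-\Delta_m)^{-\beta}H$ are tempered and convolvable, and $$(-\Delta_m)^\beta H*(-\Delta_m)^{-\beta}H=\delta .$$ Hence, for these $\beta$, $L_\beta=(-\Delta_m)^{-\beta}H$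 is a fundamental solution of the operator ${}^\beta\!\mathcal{L}$, that is, ${}^\beta\!\mathcal{L}[L_\beta]=\delta$. -/

import Mathlib

open MeasureTheory Set
open scoped SchwartzMap LineDeriv

noncomputable section

namespace CliffordPotentials

/-- Euclidean space `ℝ^m`. -/
abbrev Space (m : ℕ) : Type := EuclideanSpace ℝ (Fin m)

/-- The quadratic form `z ↦ -(z₁² + ⋯ + z_m²)` on `ℂ^m`, i.e. the complexification of the real
quadratic form of signature `(0,m)`. -/
abbrev negForm (m : ℕ) : QuadraticForm ℂ (Fin m → ℂ) :=
  QuadraticMap.weightedSumSquares ℂ (fun _ : Fin m => (-1 : ℂ))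

/-- The complexified Clifford algebra `ℂ ⊗ ℝ_{0,m}`: the complex Clifford algebra generated by
`e_1, …, e_m` with `e_j e_k + e_k e_j = -2 δ_{jk}`. -/
abbrev Cl (m : ℕ) : Type := CliffordAlgebra (negForm m)

/-- The generator `e_j` of the Clifford algebra. -/
def e (m : ℕ) (j : Fin m) : Cl m := CliffordAlgebra.ι (negForm m) (Pi.single j 1)

/-! ### Clifford-valued tempered distributions -/

/-- A functional on scalar valued Schwartz functions with values in the Clifford algebra. It is a
Clifford-valued tempered distribution when `IsTempered` holds. -/
abbrev Functional (m : ℕ) : Type := 𝓢(Space m, ℂ) → Cl m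

/-- `T` is a Clifford-valued tempered distribution: it is linear, and all its components (in one,
equivalently every, basis of the finite-dimensional Clifford algebra) are continuous. -/
structure IsTempered {m : ℕ} (T : Functional m) : Prop where
  linear : IsLinearMap ℂ T
  continuous : ∀ ℓ : Module.Dual ℂ (Cl m), Continuous fun φ => ℓ (T φ)

/-- The Dirac delta distribution at the origin. -/
def delta (m : ℕ) : Functional m := fun φ => algebraMap ℂ (Cl m) (φ 0)

/-- The Dirac operator `∂ = ∑_j e_j ∂_{x_j}`, acting from the left on Clifford-valued distributions;
the distributional derivative is `⟨∂_{x_j} T, φ⟩ = -⟨T, ∂_{x_j} φ⟩`. -/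
def dirac {m : ℕ} (T : Functional m) : Functional m := fun φ =>
  ∑ j : Fin m, e m j * (-T (∂_{EuclideanSpace.single j (1 : ℝ)} φ))

/-- The Schwartz function `y ↦ φ (x - y)`. -/
def reflectAt {m : ℕ} (x : Space m) (φ : 𝓢(Space m, ℂ)) : 𝓢(Space m, ℂ) :=
  SchwartzMap.compSubConstCLM ℂ x
    (SchwartzMap.compCLMOfContinuousLinearEquiv ℂ (ContinuousLinearEquiv.neg ℝ) φ)

theorem reflectAt_apply {m : ℕ} (x : Space m) (φ : 𝓢(Space m, ℂ)) (y : Space m) :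
    reflectAt x φ y = φ (x - y) := by
  simp [reflectAt]

/-- The regularization `T ∗ φ` of a distribution by a Schwartz function, which is the function
`x ↦ ⟨T_y, φ (x - y)⟩`. -/
def regularize {m : ℕ} (T : Functional m) (φ : 𝓢(Space m, ℂ)) (x : Space m) : Cl m :=
  T (reflectAt x φ)

/-- `IsConvolution S T R`: the tempered distributions `S` and `T` are convolvable in `𝓢'` and
`S ∗ T = R`. This is the definition of Chevalley and Shiraishi: for all Schwartz functions `φ`, `ψ`
the functions `S ∗ φ` and `T ∗ ψ` are convolvable, i.e. `y ↦ (S ∗ φ)(y) (T ∗ ψ)(x - y)` is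
integrable, and `(S ∗ φ) ∗ (T ∗ ψ) = (R ∗ φ) ∗ ψ`. It does not need either factor to have compact
support, and `R` is determined by `S` and `T`. Integrals of Clifford-valued functions are taken
componentwise, i.e. after applying an arbitrary linear functional `ℓ`. -/
structure IsConvolution {m : ℕ} (S T R : Functional m) : Prop where
  left_tempered : IsTempered S
  right_tempered : IsTempered T
  result_tempered : IsTempered R
  integrable : ∀ (φ ψ : 𝓢(Space m, ℂ)) (x : Space m) (ℓ : Module.Dual ℂ (Cl m)),
    Integrable fun y : Space m => ℓ (regularize S φ y * regularize T ψ (x - y))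
  integral_eq : ∀ (φ ψ : 𝓢(Space m, ℂ)) (x : Space m) (ℓ : Module.Dual ℂ (Cl m)),
    ∫ y : Space m, ℓ (regularize S φ y * regularize T ψ (x - y)) =
      ∫ y : Space m, ℓ (ψ (x - y) • regularize R φ y)

/-! ### The distributions `U_λ` and `U*_λ` -/

/-- The area `σ_m = 2 π^{m/2} / Γ(m/2)` of the unit sphere `S^{m-1}` in `ℝ^m`. -/
def sphereArea (m : ℕ) : ℝ := 2 * Real.pi ^ ((m : ℝ) / 2) / Real.Gamma ((m : ℝ) / 2)

/-- The vector valued generalized spherical mean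
`Σ⁽¹⁾[φ](r) = (1/σ_m) ∫_{S^{m-1}} ω φ(rω) dS(ω)`, a function of `r ∈ ℝ`. The Clifford vector
`∑_j v_j e_j` is represented here by its coordinates `(v_j)`. -/
def sphericalMean {m : ℕ} (φ : 𝓢(Space m, ℂ)) (r : ℝ) : Fin m → ℂ :=
  ((1 / sphereArea m : ℝ) : ℂ) •
    ∫ ω : Metric.sphere (0 : Space m) 1,
      (fun j : Fin m => (((ω : Space m) j : ℝ) : ℂ) * φ (r • (ω : Space m)))
      ∂(volume : Measure (Space m)).toSphere

/-- The action on `ψ` of the classical finite part distribution `Fp r_+^μ` on the real line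
(Hadamard's finite part of `∫_0^∞ r^μ ψ(r) dr`). With `N` so large that `Re μ + N ≥ 0`, it is
`∫_0^1 r^μ (ψ(r) - ∑_{k<N} ψ⁽ᵏ⁾(0) r^k / k!) dr + ∫_1^∞ r^μ ψ(r) dr
  + ∑_{k<N, k ≠ -μ-1} ψ⁽ᵏ⁾(0) / (k! (μ+k+1))`. -/
def finitePart {V : Type*} [NormedAddCommGroup V] [NormedSpace ℂ V] (μ : ℂ) (ψ : ℝ → V) : V :=
  (∫ r in Ioc (0 : ℝ) 1, ((r : ℂ) ^ μ) •
      (ψ r - ∑ k ∈ Finset.range ⌈-μ.re⌉₊, ((r : ℂ) ^ k / (k.factorial : ℂ)) • iteratedDeriv k ψ 0))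
  + (∫ r in Ioi (1 : ℝ), ((r : ℂ) ^ μ) • ψ r)
  + ∑ k ∈ Finset.range ⌈-μ.re⌉₊,
      if μ + k + 1 = 0 then 0
      else (1 / ((k.factorial : ℂ) * (μ + k + 1))) • iteratedDeriv k ψ 0

/-- The Clifford-vector valued distribution `U_λ`:
`⟨U_λ, φ⟩ = σ_m ⟨Fp r_+^{λ+m-1}, Σ⁽¹⁾[φ]⟩`. -/
def U (m : ℕ) (lam : ℂ) : Functional m := fun φ =>
  CliffordAlgebra.ι (negForm m)
    ((sphereArea m : ℂ) • finitePart (lam + m - 1) (sphericalMean φ))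

open Classical in
/-- The normalized distribution `U*_λ`:
`U*_λ = π^{(λ+m+1)/2} U_λ / Γ((λ+m+1)/2)` if `λ` is none of `-m-1, -m-3, -m-5, …`, and
`U*_{-m-2l-1} = - π^{m/2-l} / (2^{2l+1} Γ(m/2+l+1)) ∂^{2l+1} δ` for `l = 0, 1, 2, …`. -/
def UStar (m : ℕ) (lam : ℂ) : Functional m := fun φ =>
  if h : ∃ l : ℕ, lam = -m - 2 * l - 1 then
    (-((Real.pi : ℂ) ^ ((m : ℂ) / 2 - (h.choose : ℂ)) /
      ((2 : ℂ) ^ (2 * h.choose + 1) * Complex.Gamma ((m : ℂ) / 2 + (h.choose : ℂ) + 1)))) •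
        (dirac^[2 * h.choose + 1] (delta m)) φ
  else
    ((Real.pi : ℂ) ^ ((lam + m + 1) / 2) / Complex.Gamma ((lam + m + 1) / 2)) • U m lam φ

/-! ### The operators -/

/-- The convolution kernel
`(-Δ_m)^β H = - 2^{2β} Γ((m+2β+1)/2) / π^{(m-2β+1)/2} U*_{-m-2β}`,
meaningful for `β ≠ -(m+1)/2 - n`, `n = 0, 1, 2, …`. -/
def laplaceH (m : ℕ) (β : ℂ) : Functional m := fun φ =>
  (-((2 : ℂ) ^ (2 * β) * Complex.Gamma ((m + 2 * β + 1) / 2) /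
    (Real.pi : ℂ) ^ ((m - 2 * β + 1) / 2))) • UStar m (-m - 2 * β) φ

/-- The operator `^βL[T] = (-Δ_m)^β H ∗ T`, as a relation: `opL m β T R` says that `T` is in the
domain of `^βL` (it is convolvable with the kernel) and that `^βL[T] = R`. -/
def opL (m : ℕ) (β : ℂ) (T R : Functional m) : Prop := IsConvolution (laplaceH m β) T R

/-- `E` is a fundamental solution of the operator `^βL`, i.e. `^βL[E] = δ`. -/
def IsFundamentalSolutionL (m : ℕ) (β : ℂ) (E : Functional m) : Prop := opL m β E (delta m)

/-- `L_β = (-Δ_m)^{-β} H`. -/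
def L (m : ℕ) (β : ℂ) : Functional m := laplaceH m (-β)

end CliffordPotentials

end

open MeasureTheory Set
open scoped SchwartzMap LineDeriv

noncomputable section

namespace CliffordPotentials

open Filter Topology
open scoped Pointwise FourierTransform Laplacian RealInnerProductSpace

/-! Write `K_β` for the kernel `(-Δ)^β H`. With the Fourier transform normalized by
`exp(-2πi⟨x,ξ⟩)`, `K_β` is the Fourier transform of `-i (2π)^{2β} |ξ|^{2β-1} ξ`, that is, of
`(2π|ξ|)^{2β}` times the Riesz vector `-iξ/|ξ|`. A real Clifford vector squares to minus its squared
length, so the Riesz vector squares to `1`, and the symbols of `K_β` and `K_{-β}` multiply to `1`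
off the origin (`ι_rieszSymbol_mul`). This gives `K_β * K_{-β} = δ` as long as both symbols are
locally integrable and the convolution theorem applies, here for `-m/2 < Re β < 0`
(`integral_vecMul_kernelVec_aux`). All other parameters are reached by analytic continuation in `β`,
which rests on three facts.

Holomorphy. `Fp r_+^{-2β-1}` on spherical means can only have poles at `β = l + 1/2`, because the
even Taylor coefficients of the means vanish. The zeros of `1/Γ(1/2 - β)` cancel them, which yields
the formula `kernelVec`, holomorphic except at the poles of `Γ((m+2β+1)/2)`. At `β = l + 1/2` it
agrees with the separately prescribed multiple of `∂^{2l+1} δ` (`laplaceH_eq_ι_kernelVec`).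

Fourier representation. On `-1/2 < Re β < 0` it follows from the Mellin transform of the Gaussian
identity; the identity theorem extends it to `Re β > -m/2` (`kernelVec_eq_fourier`).

Decay. For every `ε > 0`, `K_β * φ` is `O((1+|y|)^{-2 Re β - m + ε})`, locally uniformly in `β`. The
exponents for `β` and `-β` add up to `-2m + 2ε`, so the product is integrable whatever `β` is
(`exists_integrable_bound`). This gives convolvability and makes the convolution integral
holomorphic on the plane minus the two sequences of poles. That set is connected, and the integral
equals a constant on a strip, hence everywhere. -/

/-! ### Holomorphic parameter integrals -/

/-- A parametric integral of holomorphic functions that are dominated by an integrable function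
is holomorphic. -/
theorem differentiableAt_integral_of_norm_le {α : Type*} [MeasurableSpace α] {μ : Measure α}
    {V : Type*} [NormedAddCommGroup V] [NormedSpace ℂ V] [CompleteSpace V]
    {F : ℂ → α → V} {z₀ : ℂ} {ε : ℝ} (hε : 0 < ε) {bound : α → ℝ}
    (hmeas : ∀ z ∈ Metric.ball z₀ ε, AEStronglyMeasurable (F z) μ)
    (hdiff : ∀ᵐ a ∂μ, ∀ z ∈ Metric.ball z₀ ε, DifferentiableAt ℂ (fun z => F z a) z)
    (hbound : ∀ᵐ a ∂μ, ∀ z ∈ Metric.ball z₀ ε, ‖F z a‖ ≤ bound a)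
    (hint : Integrable bound μ) :
    DifferentiableAt ℂ (fun z => ∫ a, F z a ∂μ) z₀ := by
  have hz₀ : z₀ ∈ Metric.ball z₀ ε := Metric.mem_ball_self hε
  -- The derivative at `z₀` is the limit of difference quotients along a null sequence of nonzero
  -- steps inside the ball, so it inherits measurability.
  have hmeas' : AEStronglyMeasurable (fun a => deriv (fun z => F z a) z₀) μ := by
    have hu : Tendsto (fun n : ℕ => ((ε / 2 * (1 / ((n : ℝ) + 1)) : ℝ) : ℂ)) atTop (𝓝[≠] 0) := by
      rw [tendsto_nhdsWithin_iff]
      constructor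
      · have := (tendsto_one_div_add_atTop_nhds_zero_nat (𝕜 := ℝ)).const_mul (ε / 2)
        rw [mul_zero] at this
        exact_mod_cast (Complex.continuous_ofReal.tendsto 0).comp this
      · refine Eventually.of_forall fun n => ?_
        have : 0 < ε / 2 * (1 / ((n : ℝ) + 1)) := by positivity
        exact Complex.ofReal_ne_zero.2 this.ne'
    refine aestronglyMeasurable_of_tendsto_ae atTop
      (f := fun (n : ℕ) a => ((ε / 2 * (1 / ((n : ℝ) + 1)) : ℝ) : ℂ)⁻¹ •
        (F (z₀ + ((ε / 2 * (1 / ((n : ℝ) + 1)) : ℝ) : ℂ)) a - F z₀ a)) (fun n => ?_) ?_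
    · refine ((hmeas _ ?_).sub (hmeas _ hz₀)).const_smul _
      have h1 : 1 / ((n : ℝ) + 1) ≤ 1 := by
        rw [div_le_one (by positivity)]; linarith [Nat.cast_nonneg (α := ℝ) n]
      have h0 : 0 < 1 / ((n : ℝ) + 1) := by positivity
      rw [mem_ball_iff_norm, add_sub_cancel_left, Complex.norm_real, Real.norm_eq_abs,
        abs_of_pos (by positivity)]
      nlinarith
    · filter_upwards [hdiff] with a ha
      exact (hasDerivAt_iff_tendsto_slope_zero.1 (ha z₀ hz₀).hasDerivAt).comp hu
  refine (hasDerivAt_integral_of_dominated_loc_of_deriv_le (F' := fun z a => deriv (fun z => F z a) z)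
    (bound := fun a => bound a / (ε / 3)) (Metric.ball_mem_nhds z₀ (show 0 < ε / 2 by positivity))
    ?_ ?_ hmeas' ?_ ?_ ?_).2.differentiableAt
  · filter_upwards [Metric.ball_mem_nhds z₀ hε] with z hz using hmeas z hz
  · exact hint.mono' (hmeas _ hz₀) (hbound.mono fun a h => h z₀ hz₀)
  · filter_upwards [hdiff, hbound] with a hd hb z hz
    -- Cauchy's estimate on the circle of radius `ε/3` about `z`; as `z` stays within `ε/2` of `z₀`
    -- and `1/2 + 1/3 < 1`, the circle lies where `bound` applies.
    have hsub : Metric.closedBall z (ε / 3) ⊆ Metric.ball z₀ ε := by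
      intro w hw
      rw [Metric.mem_closedBall] at hw
      rw [Metric.mem_ball] at hz ⊢
      linarith [dist_triangle w z z₀]
    refine Complex.norm_deriv_le_of_forall_mem_sphere_norm_le (by positivity) ?_
      fun w hw => hb w (hsub (Metric.sphere_subset_closedBall hw))
    refine DifferentiableOn.diffContOnCl fun w hw => ?_
    rw [closure_ball _ (by positivity)] at hw
    exact (hd w (hsub hw)).differentiableWithinAt
  · exact hint.div_const _
  · filter_upwards [hdiff] with a hd z hz
    exact (hd z (Metric.ball_subset_ball (by linarith) hz)).hasDerivAt

/-! ### Polar coordinates and the surface measure -/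

section Polar

variable {E : Type*} [NormedAddCommGroup E] [NormedSpace ℝ E] [FiniteDimensional ℝ E]
  [MeasurableSpace E] [BorelSpace E] {F : Type*} [NormedAddCommGroup F] [NormedSpace ℝ F]

/-- Integration in polar coordinates. -/
theorem integral_eq_integral_toSphere [Nontrivial E] (μ : Measure E) [μ.IsAddHaarMeasure] {f : E → F}
    (hf : Integrable f μ) :
    ∫ x, f x ∂μ = ∫ r in Ioi (0 : ℝ), r ^ (Module.finrank ℝ E - 1) •
      ∫ ω : Metric.sphere (0 : E) 1, f (r • (ω : E)) ∂μ.toSphere := by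
  have hmp := μ.measurePreserving_homeomorphUnitSphereProd
  have hme := (Homeomorph.measurableEmbedding (homeomorphUnitSphereProd E))
  let g : Metric.sphere (0 : E) 1 × Ioi (0 : ℝ) → F := fun p => f (p.2.1 • (p.1 : E))
  have hg : ∀ x : ({0}ᶜ : Set E), g (homeomorphUnitSphereProd E x) = f x := by
    intro x
    have : ‖(x : E)‖ ≠ 0 := norm_ne_zero_iff.2 x.2
    simp [g, smul_smul, this]
  have hgi : Integrable g (μ.toSphere.prod (Measure.volumeIoiPow (Module.finrank ℝ E - 1))) := by
    rw [← hmp.integrable_comp_emb hme]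
    have : (g ∘ homeomorphUnitSphereProd E) = f ∘ Subtype.val := funext hg
    rw [this, ← integrableOn_iff_comap_subtypeVal (measurableSet_singleton _).compl]
    exact hf.integrableOn
  calc
    ∫ x, f x ∂μ = ∫ x : ({0}ᶜ : Set E), f x.1 ∂(μ.comap (↑)) := by
      rw [integral_subtype_comap (measurableSet_singleton _).compl f,
        restrict_compl_singleton]
    _ = ∫ p, g p ∂(μ.toSphere.prod (Measure.volumeIoiPow (Module.finrank ℝ E - 1))) := by
      rw [← hmp.integral_comp hme]
      exact integral_congr_ae (Eventually.of_forall fun x => (hg x).symm)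
    _ = ∫ r : Ioi (0 : ℝ), ∫ ω, g (ω, r) ∂μ.toSphere
          ∂(Measure.volumeIoiPow (Module.finrank ℝ E - 1)) := integral_prod_symm _ hgi
    _ = _ := by
      simp only [Measure.volumeIoiPow, ENNReal.ofReal]
      rw [integral_withDensity_eq_integral_smul,
        integral_subtype_comap measurableSet_Ioi fun a : ℝ =>
          Real.toNNReal (a ^ (Module.finrank ℝ E - 1)) •
            ∫ ω : Metric.sphere (0 : E) 1, f (a • (ω : E)) ∂μ.toSphere,
        setIntegral_congr_fun measurableSet_Ioi fun x hx => ?_]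
      · rw [NNReal.smul_def, Real.coe_toNNReal _ (pow_nonneg hx.out.le _)]
      · exact (measurable_subtype_coe.pow_const _).real_toNNReal

/-- The surface measure of a set is the dimension times the volume of the cone over it, and the cone
over `-s` is the reflection of the cone over `s`. -/
theorem measurePreserving_neg_toSphere (μ : Measure E) [μ.IsAddHaarMeasure] :
    MeasurePreserving (fun ω : Metric.sphere (0 : E) 1 => -ω) μ.toSphere μ.toSphere := by
  refine ⟨continuous_neg.measurable, Measure.ext fun s hs => ?_⟩
  rw [Measure.map_apply continuous_neg.measurable hs, Measure.toSphere_apply' _ hs,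
    Measure.toSphere_apply' _ (continuous_neg.measurable hs)]
  congr 1
  have : (Ioo (0 : ℝ) 1) • ((fun ω : Metric.sphere (0 : E) 1 => (ω : E)) '' ((fun ω => -ω) ⁻¹' s))
      = -(Ioo (0 : ℝ) 1 • ((fun ω : Metric.sphere (0 : E) 1 => (ω : E)) '' s)) := by
    ext x
    simp only [Set.mem_neg, Set.mem_smul, mem_image, mem_preimage]
    constructor
    · rintro ⟨r, hr, _, ⟨ω, hω, rfl⟩, rfl⟩
      exact ⟨r, hr, _, ⟨-ω, hω, rfl⟩, by simp⟩
    · rintro ⟨r, hr, _, ⟨ω, hω, rfl⟩, h⟩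
      exact ⟨r, hr, _, ⟨-ω, by simpa using hω, rfl⟩, by simp [h]⟩
  rw [this, Measure.measure_neg]

end Polar

/-! ### Spherical moments and their Taylor remainders -/

/-- The coordinates of a real vector, as a complex vector. -/
def cvec {m : ℕ} (x : Space m) : Fin m → ℂ := fun j => ((x j : ℝ) : ℂ)

theorem norm_cvec_le {m : ℕ} (x : Space m) : ‖cvec x‖ ≤ ‖x‖ := by
  refine (pi_norm_le_iff_of_nonneg (norm_nonneg _)).2 fun j => ?_
  simpa [cvec] using PiLp.norm_apply_le x j

theorem continuous_cvec {m : ℕ} : Continuous (cvec (m := m)) := by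
  unfold cvec; fun_prop

/-- The surface measure on the unit sphere. -/
abbrev sphereMeasure (m : ℕ) : Measure (Metric.sphere (0 : Space m) 1) :=
  (volume : Measure (Space m)).toSphere

/-- The `k`-th derivative of `t ↦ φ (t ω)` at `r`. -/
def radialDeriv {m : ℕ} (k : ℕ) (φ : 𝓢(Space m, ℂ)) (r : ℝ) (ω : Space m) : ℂ :=
  iteratedFDeriv ℝ k φ (r • ω) (fun _ => ω)

/-- The integral of `ω` times the `k`-th radial derivative of `φ` over the sphere of radius `r`. -/
def sphMoment {m : ℕ} (k : ℕ) (φ : 𝓢(Space m, ℂ)) (r : ℝ) : Fin m → ℂ :=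
  ∫ ω : Metric.sphere (0 : Space m) 1, radialDeriv k φ r ω • cvec (ω : Space m) ∂sphereMeasure m

section

variable {m : ℕ} (k : ℕ) (φ ψ : 𝓢(Space m, ℂ))

theorem continuous_iteratedFDeriv_schwartz : Continuous (iteratedFDeriv ℝ k φ) :=
  (φ.smooth ⊤).continuous_iteratedFDeriv (mod_cast le_top)

theorem continuous_radialDeriv :
    Continuous fun p : ℝ × Space m => radialDeriv k φ p.1 p.2 := by
  unfold radialDeriv
  have h1 : Continuous fun p : ℝ × Space m => iteratedFDeriv ℝ k φ (p.1 • p.2) :=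
    (continuous_iteratedFDeriv_schwartz k φ).comp (by fun_prop)
  fun_prop

theorem norm_radialDeriv_le (r : ℝ) {ω : Space m} (hω : ‖ω‖ = 1) :
    ‖radialDeriv k φ r ω‖ ≤ ‖iteratedFDeriv ℝ k φ (r • ω)‖ := by
  refine (ContinuousMultilinearMap.le_opNorm _ _).trans ?_
  simp [hω]

theorem hasDerivAt_radialDeriv (r : ℝ) (ω : Space m) :
    HasDerivAt (fun r => radialDeriv k φ r ω) (radialDeriv (k + 1) φ r ω) r := by
  have h1 : HasFDerivAt (iteratedFDeriv ℝ k φ) (fderiv ℝ (iteratedFDeriv ℝ k φ) (r • ω)) (r • ω) :=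
    (((φ.smooth ⊤).differentiable_iteratedFDeriv
      (by exact_mod_cast (ENat.natCast_lt_top k))) _).hasFDerivAt
  have h2 : HasDerivAt (fun t : ℝ => t • ω) ω r := by
    simpa using (hasDerivAt_id r).smul_const ω
  have h3 := h1.comp_hasDerivAt r h2
  have h4 := (ContinuousMultilinearMap.apply ℝ (fun _ : Fin k => Space m) ℂ
    (fun _ => ω)).hasFDerivAt.comp_hasDerivAt r h3
  exact h4

theorem radialDeriv_add (r : ℝ) (ω : Space m) :
    radialDeriv k (φ + ψ) r ω = radialDeriv k φ r ω + radialDeriv k ψ r ω := by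
  change iteratedFDeriv ℝ k (⇑φ + ⇑ψ) (r • ω) (fun _ => ω) = _
  rw [iteratedFDeriv_add_apply
    ((φ.smooth ⊤).of_le (mod_cast le_top)).contDiffAt
    ((ψ.smooth ⊤).of_le (mod_cast le_top)).contDiffAt]
  rfl

theorem radialDeriv_smul (c : ℂ) (r : ℝ) (ω : Space m) :
    radialDeriv k (c • φ) r ω = c * radialDeriv k φ r ω := by
  change iteratedFDeriv ℝ k (c • ⇑φ) (r • ω) (fun _ => ω) = _
  rw [iteratedFDeriv_const_smul_apply
    ((φ.smooth ⊤).of_le (mod_cast le_top)).contDiffAt]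
  rfl

theorem continuous_radialDeriv_smul_cvec :
    Continuous fun p : ℝ × Metric.sphere (0 : Space m) 1 =>
      radialDeriv k φ p.1 p.2 • cvec (p.2 : Space m) :=
  ((continuous_radialDeriv k φ).comp
    (f := fun p : ℝ × Metric.sphere (0 : Space m) 1 => (p.1, (p.2 : Space m)))
    (by fun_prop)).smul (continuous_cvec.comp (by fun_prop))

theorem norm_radialDeriv_smul_cvec_le (r : ℝ) (ω : Metric.sphere (0 : Space m) 1) :
    ‖radialDeriv k φ r ω • cvec (ω : Space m)‖ ≤ ‖iteratedFDeriv ℝ k φ (r • (ω : Space m))‖ := by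
  have hω : ‖(ω : Space m)‖ = 1 := by simp
  rw [norm_smul]
  have h1 := norm_radialDeriv_le k φ r hω
  have h2 := norm_cvec_le (ω : Space m)
  rw [hω] at h2
  calc _ ≤ ‖radialDeriv k φ r ω‖ * 1 := by gcongr
    _ ≤ _ := by linarith

theorem integrable_radialDeriv_smul_cvec (r : ℝ) :
    Integrable (fun ω : Metric.sphere (0 : Space m) 1 =>
      radialDeriv k φ r ω • cvec (ω : Space m)) (sphereMeasure m) := by
  refine Continuous.integrable_of_hasCompactSupport ?_ (HasCompactSupport.of_compactSpace _)
  exact (continuous_radialDeriv_smul_cvec k φ).comp (by fun_prop :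
    Continuous fun ω : Metric.sphere (0 : Space m) 1 => (r, ω))

theorem sphMoment_add (r : ℝ) :
    sphMoment k (φ + ψ) r = sphMoment k φ r + sphMoment k ψ r := by
  unfold sphMoment
  rw [← integral_add (integrable_radialDeriv_smul_cvec k φ r)
    (integrable_radialDeriv_smul_cvec k ψ r)]
  simp_rw [radialDeriv_add, add_smul]

theorem sphMoment_smul (c : ℂ) (r : ℝ) : sphMoment k (c • φ) r = c • sphMoment k φ r := by
  unfold sphMoment
  rw [← integral_smul]
  simp_rw [radialDeriv_smul, mul_smul]

theorem norm_sphMoment_le (r : ℝ) {C : ℝ}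
    (hC : ∀ ω : Space m, ‖ω‖ = 1 → ‖iteratedFDeriv ℝ k φ (r • ω)‖ ≤ C) :
    ‖sphMoment k φ r‖ ≤ C * (sphereMeasure m).real univ :=
  norm_integral_le_of_norm_le_const (Eventually.of_forall fun ω =>
    (norm_radialDeriv_smul_cvec_le k φ r ω).trans (hC _ (by simp)))

theorem hasDerivAt_sphMoment (r : ℝ) :
    HasDerivAt (sphMoment k φ) (sphMoment (k + 1) φ r) r := by
  refine (hasDerivAt_integral_of_dominated_loc_of_deriv_le
    (F := fun r (ω : Metric.sphere (0 : Space m) 1) => radialDeriv k φ r ω • cvec (ω : Space m))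
    (F' := fun r (ω : Metric.sphere (0 : Space m) 1) =>
      radialDeriv (k + 1) φ r ω • cvec (ω : Space m))
    (bound := fun _ => SchwartzMap.seminorm ℝ 0 (k + 1) φ) univ_mem
    (Eventually.of_forall fun r => (integrable_radialDeriv_smul_cvec k φ r).1)
    (integrable_radialDeriv_smul_cvec k φ r)
    (integrable_radialDeriv_smul_cvec (k + 1) φ r).1
    (Eventually.of_forall fun ω r _ => (norm_radialDeriv_smul_cvec_le _ φ r ω).trans
      (φ.norm_iteratedFDeriv_le_seminorm ℝ _ _))
    (integrable_const _)
    (Eventually.of_forall fun ω r _ => ?_)).2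
  exact (hasDerivAt_radialDeriv k φ r ω).smul_const _

/-- Differentiation under the integral sign raises the order of the moment by one. This identifies
the Taylor coefficients that Hadamard's finite part subtracts. -/
theorem iteratedDeriv_sphMoment : iteratedDeriv k (sphMoment 0 φ) = sphMoment k φ := by
  induction k with
  | zero => simp
  | succ k ih =>
    rw [iteratedDeriv_succ, ih]
    exact funext fun r => (hasDerivAt_sphMoment k φ r).deriv

theorem contDiff_sphMoment : ContDiff ℝ (⊤ : ℕ∞) (sphMoment 0 φ) := by
  refine contDiff_of_differentiable_iteratedDeriv fun n _ => ?_
  rw [iteratedDeriv_sphMoment]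
  exact fun r => (hasDerivAt_sphMoment n φ r).differentiableAt

theorem sphericalMean_eq : sphericalMean φ = ((1 / sphereArea m : ℝ) : ℂ) • sphMoment 0 φ := by
  have h : ∀ (r : ℝ) (ω : Metric.sphere (0 : Space m) 1),
      (fun j : Fin m => (((ω : Space m) j : ℝ) : ℂ) * φ (r • (ω : Space m)))
        = radialDeriv 0 φ r ω • cvec (ω : Space m) := by
    intro r ω
    ext i
    simp [radialDeriv, cvec, mul_comm]
  funext r
  rw [Pi.smul_apply]
  exact congrArg _ (integral_congr_ae (Eventually.of_forall (h r)))

/-- At the origin an even-order radial derivative is even in `ω`, while the factor `ω` is odd, so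
the integral over the sphere cancels. This leaves poles of the finite part only at odd values of
`2β`. -/
theorem sphMoment_zero_of_even (hk : Even k) : sphMoment k φ 0 = 0 := by
  have h := (measurePreserving_neg_toSphere (volume : Measure (Space m))).integral_comp
    (MeasurableEquiv.neg _).measurableEmbedding
    (fun ω : Metric.sphere (0 : Space m) 1 => radialDeriv k φ 0 ω • cvec (ω : Space m))
  have h1 : ∀ ω : Metric.sphere (0 : Space m) 1,
      radialDeriv k φ 0 ((-ω : Metric.sphere (0 : Space m) 1) : Space m) •
        cvec ((-ω : Metric.sphere (0 : Space m) 1) : Space m)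
        = -(radialDeriv k φ 0 ω • cvec (ω : Space m)) := by
    intro ω
    have h2 : cvec ((-ω : Metric.sphere (0 : Space m) 1) : Space m) = -cvec (ω : Space m) := by
      ext j; simp [cvec]
    have h3 : radialDeriv k φ 0 ((-ω : Metric.sphere (0 : Space m) 1) : Space m)
        = radialDeriv k φ 0 ω := by
      have := (iteratedFDeriv ℝ k φ 0).map_smul_univ (fun _ => (-1 : ℝ)) (fun _ => (ω : Space m))
      simpa [radialDeriv, hk.neg_one_pow] using this
    rw [h2, h3, smul_neg]
  simp_rw [h1] at h
  rw [integral_neg] at h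
  have h4 : -sphMoment k φ 0 = sphMoment k φ 0 := h
  exact self_eq_neg.1 h4.symm

/-- The Taylor polynomial of order `n` of the spherical moment. -/
def sphRemainder (n : ℕ) (φ : 𝓢(Space m, ℂ)) (r : ℝ) : Fin m → ℂ :=
  sphMoment 0 φ r - ∑ k ∈ Finset.range n, ((r : ℂ) ^ k / (k.factorial : ℂ)) • sphMoment k φ 0

/-- Taylor's theorem with remainder. The constant depends only on derivatives in the unit ball,
which later yields rapid decay when the test function is translated away. -/
theorem norm_sphRemainder_le {C r : ℝ} (hr : r ∈ Icc (0 : ℝ) 1)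
    (hC : ∀ x : Space m, ‖x‖ ≤ 1 → ‖iteratedFDeriv ℝ k φ x‖ ≤ C) :
    ‖sphRemainder k φ r‖ ≤ C * (sphereMeasure m).real univ * r ^ k := by
  have hball : ∀ t ∈ Icc (0 : ℝ) 1, ∀ ω : Space m, ‖ω‖ = 1 → ‖t • ω‖ ≤ 1 := by
    intro t ht ω hω
    rw [norm_smul, hω, mul_one, Real.norm_eq_abs, abs_of_nonneg ht.1]
    exact ht.2
  have hM : ∀ t ∈ Icc (0 : ℝ) 1, ‖sphMoment k φ t‖ ≤ C * (sphereMeasure m).real univ :=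
    fun t ht => norm_sphMoment_le k φ t fun ω hω => hC _ (hball t ht ω hω)
  -- The mean remainder bound of order `n` uses the derivative of order `n + 1`, so order zero is
  -- treated apart; there the Taylor polynomial is empty.
  cases k with
  | zero => simpa [sphRemainder] using hM r hr
  | succ n =>
    have hcd : ∀ k : ℕ, ∀ t ∈ Icc (0 : ℝ) 1,
        iteratedDerivWithin k (sphMoment 0 φ) (Icc 0 1) t = sphMoment k φ t := by
      intro k t ht
      rw [iteratedDerivWithin_eq_iteratedDeriv (uniqueDiffOn_Icc zero_lt_one)
        ((contDiff_sphMoment φ).of_le (mod_cast le_top)).contDiffAt ht, iteratedDeriv_sphMoment]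
    have h := taylor_mean_remainder_bound (n := n) (zero_le_one (α := ℝ))
      ((contDiff_sphMoment φ).of_le (mod_cast le_top)).contDiffOn hr
      (fun y hy => by rw [hcd _ y hy]; exact hM y hy)
    rw [taylor_within_apply, sub_zero] at h
    have h0 : (0 : ℝ) ∈ Icc (0 : ℝ) 1 := ⟨le_rfl, zero_le_one⟩
    simp_rw [hcd _ 0 h0] at h
    have hC0 : 0 ≤ C * (sphereMeasure m).real univ := (norm_nonneg _).trans (hM 0 h0)
    have heq : sphRemainder (n + 1) φ r = sphMoment 0 φ r -
        ∑ k ∈ Finset.range (n + 1), ((k.factorial : ℝ)⁻¹ * r ^ k) • sphMoment k φ 0 := by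
      unfold sphRemainder
      congr 1
      refine Finset.sum_congr rfl fun k _ => ?_
      ext j
      simp only [Pi.smul_apply, smul_eq_mul, Complex.real_smul]
      push_cast
      ring
    rw [heq]
    refine h.trans (div_le_self (by have := hr.1; positivity) ?_)
    exact_mod_cast Nat.one_le_iff_ne_zero.2 n.factorial_ne_zero

theorem continuous_sphRemainder : Continuous (sphRemainder k φ) := by
  unfold sphRemainder
  have := (contDiff_sphMoment φ).continuous
  fun_prop

end

/-! ### The finite part and its holomorphic normalization -/

variable {m : ℕ}

/-- The contribution of the unit ball to the finite part integral, after subtraction of a Taylor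
polynomial. -/
def innerPart (n : ℕ) (β : ℂ) (φ : 𝓢(Space m, ℂ)) : Fin m → ℂ :=
  ∫ r in Ioc (0 : ℝ) 1, ((r : ℂ) ^ (-2 * β - 1)) • sphRemainder n φ r

/-- The contribution of the complement of the unit ball to the finite part integral. -/
def outerPart (β : ℂ) (φ : 𝓢(Space m, ℂ)) : Fin m → ℂ :=
  ∫ z in {z : Space m | 1 < ‖z‖}, (((‖z‖ : ℝ) : ℂ) ^ (-2 * β - m - 1) * φ z) • cvec z

/-- The entire function that continues `β ↦ 1 / (Γ (1/2 - β) (2 l + 1 - 2 β))`. -/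
def taylorCoeff (l : ℕ) (β : ℂ) : ℂ :=
  (∏ i ∈ Finset.range l, ((i : ℂ) + 1 / 2 - β)) / 2 * (Complex.Gamma (l + 3 / 2 - β))⁻¹

/-- The normalizing constant of the kernel of `(-Δ)^β H`. -/
def kernelConst (m : ℕ) (β : ℂ) : ℂ :=
  -((2 : ℂ) ^ (2 * β) * Complex.Gamma ((m + 2 * β + 1) / 2) * (Real.pi : ℂ) ^ (-(m : ℂ) / 2))

/-- The Clifford vector `⟨(-Δ)^β H, φ⟩`, in coordinates, in a form which is holomorphic in `β`
for `Re β < N`. -/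
def kernelVec (N : ℕ) (β : ℂ) (φ : 𝓢(Space m, ℂ)) : Fin m → ℂ :=
  kernelConst m β • ((Complex.Gamma (1 / 2 - β))⁻¹ • (innerPart (2 * N) β φ + outerPart β φ) +
    ∑ l ∈ Finset.range N,
      (taylorCoeff l β / ((2 * l + 1).factorial : ℂ)) • sphMoment (2 * l + 1) φ 0)

theorem norm_innerIntegrand_le {n : ℕ} {β : ℂ} (φ : 𝓢(Space m, ℂ)) {C : ℝ}
    (hC : ∀ x : Space m, ‖x‖ ≤ 1 → ‖iteratedFDeriv ℝ n φ x‖ ≤ C) {r : ℝ} (hr : r ∈ Ioc (0 : ℝ) 1) :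
    ‖((r : ℂ) ^ (-2 * β - 1)) • sphRemainder n φ r‖ ≤
      C * (sphereMeasure m).real univ * r ^ ((n : ℝ) - 2 * β.re - 1) := by
  have h := norm_sphRemainder_le n φ ⟨hr.1.le, hr.2⟩ hC
  rw [norm_smul, Complex.norm_cpow_eq_rpow_re_of_pos hr.1]
  have h2 : r ^ ((n : ℝ) - 2 * β.re - 1) = r ^ (-2 * β - 1).re * r ^ n := by
    rw [← Real.rpow_natCast, ← Real.rpow_add hr.1]
    congr 1
    simp
    ring
  rw [h2]
  have := mul_le_mul_of_nonneg_left h (Real.rpow_nonneg hr.1.le (-2 * β - 1).re)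
  linarith

theorem integrableOn_rpow_Ioc {s : ℝ} (hs : -1 < s) :
    IntegrableOn (fun r : ℝ => r ^ s) (Ioc 0 1) := by
  rw [← intervalIntegrable_iff_integrableOn_Ioc_of_le zero_le_one]
  exact intervalIntegral.intervalIntegrable_rpow' hs

theorem integral_rpow_Ioc {s : ℝ} (hs : -1 < s) :
    ∫ r in Ioc (0 : ℝ) 1, r ^ s = 1 / (s + 1) := by
  rw [← intervalIntegral.integral_of_le zero_le_one, integral_rpow (Or.inl hs)]
  simp [Real.zero_rpow (by linarith : s + 1 ≠ 0)]

theorem measurable_cpow_ofReal (s : ℂ) : Measurable fun r : ℝ => (r : ℂ) ^ s :=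
  Complex.measurable_ofReal.pow_const s

theorem aestronglyMeasurable_innerIntegrand (n : ℕ) (β : ℂ) (φ : 𝓢(Space m, ℂ)) :
    AEStronglyMeasurable (fun r : ℝ => ((r : ℂ) ^ (-2 * β - 1)) • sphRemainder n φ r)
      (volume.restrict (Ioc (0 : ℝ) 1)) :=
  ((measurable_cpow_ofReal _).aestronglyMeasurable).smul
    (continuous_sphRemainder n φ).aestronglyMeasurable

theorem exists_bound_iteratedFDeriv (n : ℕ) (φ : 𝓢(Space m, ℂ)) :
    ∃ C, ∀ x : Space m, ‖iteratedFDeriv ℝ n φ x‖ ≤ C :=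
  ⟨_, fun x => φ.norm_iteratedFDeriv_le_seminorm ℝ n x⟩

theorem integrableOn_innerIntegrand {n : ℕ} {β : ℂ} (h : 2 * β.re < n) (φ : 𝓢(Space m, ℂ)) :
    IntegrableOn (fun r : ℝ => ((r : ℂ) ^ (-2 * β - 1)) • sphRemainder n φ r) (Ioc 0 1) := by
  obtain ⟨C, hC⟩ := exists_bound_iteratedFDeriv n φ
  refine ((integrableOn_rpow_Ioc (s := n - 2 * β.re - 1) (by linarith)).const_mul
    (C * (sphereMeasure m).real univ)).mono' (aestronglyMeasurable_innerIntegrand n β φ) ?_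
  filter_upwards [ae_restrict_mem measurableSet_Ioc] with r hr
  exact norm_innerIntegrand_le φ (fun x _ => hC x) hr

theorem norm_innerPart_le {n : ℕ} {β : ℂ} (h : 2 * β.re < n) (φ : 𝓢(Space m, ℂ)) {C : ℝ}
    (hC : ∀ x : Space m, ‖x‖ ≤ 1 → ‖iteratedFDeriv ℝ n φ x‖ ≤ C) :
    ‖innerPart n β φ‖ ≤ C * (sphereMeasure m).real univ / (n - 2 * β.re) := by
  have hs : (-1 : ℝ) < n - 2 * β.re - 1 := by linarith
  refine (norm_integral_le_of_norm_le ((integrableOn_rpow_Ioc hs).const_mul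
    (C * (sphereMeasure m).real univ)) ?_).trans ?_
  · filter_upwards [ae_restrict_mem measurableSet_Ioc] with r hr
    exact norm_innerIntegrand_le φ hC hr
  · rw [integral_const_mul, integral_rpow_Ioc hs]
    simp [div_eq_mul_inv]

theorem sphRemainder_succ (n : ℕ) (φ : 𝓢(Space m, ℂ)) (r : ℝ) :
    sphRemainder (n + 1) φ r =
      sphRemainder n φ r - ((r : ℂ) ^ n / (n.factorial : ℂ)) • sphMoment n φ 0 := by
  unfold sphRemainder
  rw [Finset.sum_range_succ, sub_sub]

/-- One more Taylor term is moved out of the integral; its weight is `∫_0^1 r^{n-2β-1} dr = 1/(n -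
2β)`, convergent as `2 Re β < n`. -/
theorem innerPart_succ {n : ℕ} {β : ℂ} (h : 2 * β.re < n) (φ : 𝓢(Space m, ℂ)) :
    innerPart n β φ = innerPart (n + 1) β φ +
      (1 / ((n.factorial : ℂ) * (n - 2 * β))) • sphMoment n φ 0 := by
  have hs : -1 < ((n : ℂ) - 2 * β - 1).re := by simp; linarith
  have hne : (n : ℂ) - 2 * β ≠ 0 := fun h0 => by
    have := congrArg Complex.re h0
    simp at this
    linarith
  have h1 : ∀ r ∈ Ioc (0 : ℝ) 1, ((r : ℂ) ^ (-2 * β - 1)) • sphRemainder n φ r =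
      ((r : ℂ) ^ (-2 * β - 1)) • sphRemainder (n + 1) φ r +
        ((r : ℂ) ^ ((n : ℂ) - 2 * β - 1)) • ((1 / (n.factorial : ℂ)) • sphMoment n φ 0) := by
    intro r hr
    have hr0 : (r : ℂ) ≠ 0 := by exact_mod_cast hr.1.ne'
    have : (r : ℂ) ^ ((n : ℂ) - 2 * β - 1) = (r : ℂ) ^ (-2 * β - 1) * (r : ℂ) ^ n := by
      rw [← Complex.cpow_natCast, ← Complex.cpow_add _ _ hr0]
      congr 1
      ring
    rw [sphRemainder_succ, this, smul_sub, smul_smul, smul_smul, mul_div_assoc', mul_one_div,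
      sub_add_cancel]
  have h2 : IntegrableOn (fun r : ℝ => (r : ℂ) ^ ((n : ℂ) - 2 * β - 1)) (Ioc 0 1) := by
    rw [← intervalIntegrable_iff_integrableOn_Ioc_of_le zero_le_one]
    exact intervalIntegral.intervalIntegrable_cpow' hs
  have h3 : ∫ r in Ioc (0 : ℝ) 1, (r : ℂ) ^ ((n : ℂ) - 2 * β - 1) = 1 / ((n : ℂ) - 2 * β) := by
    rw [← intervalIntegral.integral_of_le zero_le_one, integral_cpow (Or.inl hs)]
    simp [Complex.zero_cpow hne]
  unfold innerPart
  rw [setIntegral_congr_fun measurableSet_Ioc h1, integral_add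
    (integrableOn_innerIntegrand (by push_cast; linarith) φ) (h2.smul_const _),
    integral_smul_const, h3, smul_smul]
  congr 2
  field_simp

theorem innerPart_eq_add_sum {n : ℕ} {β : ℂ} (h : 2 * β.re < n) (φ : 𝓢(Space m, ℂ)) (d : ℕ) :
    innerPart n β φ = innerPart (n + d) β φ +
      ∑ k ∈ Finset.Ico n (n + d), (1 / ((k.factorial : ℂ) * (k - 2 * β))) • sphMoment k φ 0 := by
  induction d with
  | zero => simp
  | succ d ih =>
    rw [ih, innerPart_succ (n := n + d) (by push_cast; linarith [Nat.cast_nonneg (α := ℝ) d]) φ,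
      ← add_assoc n d 1, Finset.sum_Ico_succ_top (by omega), add_assoc, add_comm (_ • _)]

theorem outerPart_integrableOn (β : ℂ) (φ : 𝓢(Space m, ℂ)) :
    IntegrableOn (fun z : Space m => (((‖z‖ : ℝ) : ℂ) ^ (-2 * β - m - 1) * φ z) • cvec z)
      {z | 1 < ‖z‖} := by
  obtain ⟨k, hk⟩ := exists_nat_ge ((-2 * β - m - 1).re + 1)
  refine (φ.integrable_pow_mul volume k).integrableOn.mono' ?_ ?_
  · have h1 : Measurable fun z : Space m => ((‖z‖ : ℝ) : ℂ) ^ (-2 * β - m - 1) :=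
      (measurable_cpow_ofReal _).comp measurable_norm
    exact ((h1.aestronglyMeasurable.mul φ.continuous.aestronglyMeasurable).smul
      continuous_cvec.aestronglyMeasurable)
  · filter_upwards [ae_restrict_mem (measurableSet_lt measurable_const measurable_norm)] with z hz
    have hz : 1 < ‖z‖ := hz
    have hz0 : 0 < ‖z‖ := by linarith
    rw [norm_smul, norm_mul, Complex.norm_cpow_eq_rpow_re_of_pos hz0]
    have h1 : ‖z‖ ^ (-2 * β - m - 1).re * ‖z‖ ≤ ‖z‖ ^ k := by
      rw [← Real.rpow_natCast]
      nth_rw 2 [← Real.rpow_one ‖z‖]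
      rw [← Real.rpow_add hz0]
      exact Real.rpow_le_rpow_of_exponent_le hz.le hk
    calc _ ≤ ‖z‖ ^ (-2 * β - m - 1).re * ‖φ z‖ * ‖z‖ := by
          gcongr; exact norm_cvec_le z
      _ = ‖z‖ ^ (-2 * β - m - 1).re * ‖z‖ * ‖φ z‖ := by ring
      _ ≤ _ := by gcongr

theorem cvec_smul (r : ℝ) (z : Space m) : cvec (r • z) = (r : ℂ) • cvec z := by
  ext j; simp [cvec]

theorem radialDeriv_zero (φ : 𝓢(Space m, ℂ)) (r : ℝ) (ω : Space m) :
    radialDeriv 0 φ r ω = φ (r • ω) := by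
  simp [radialDeriv]

theorem nontrivial_space (hm : 1 ≤ m) : Nontrivial (Space m) :=
  Module.nontrivial_of_finrank_pos (R := ℝ) (by simp; omega)

/-- The integral of a homogeneous vector valued kernel over a radially symmetric set, in polar
coordinates. -/
theorem setIntegral_cpow_smul_cvec (hm : 1 ≤ m) (β : ℂ) (φ : 𝓢(Space m, ℂ)) {s : Set ℝ}
    (hs : MeasurableSet s)
    (hi : IntegrableOn (fun z : Space m => (((‖z‖ : ℝ) : ℂ) ^ (-2 * β - m - 1) * φ z) • cvec z)
      {z | ‖z‖ ∈ s}) :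
    ∫ z in {z : Space m | ‖z‖ ∈ s}, (((‖z‖ : ℝ) : ℂ) ^ (-2 * β - m - 1) * φ z) • cvec z =
      ∫ r in Ioi 0 ∩ s, ((r : ℂ) ^ (-2 * β - 1)) • sphMoment 0 φ r := by
  have := nontrivial_space hm
  have hms : MeasurableSet {z : Space m | ‖z‖ ∈ s} := measurable_norm hs
  rw [← integral_indicator hms, integral_eq_integral_toSphere volume
    (hi.integrable_indicator hms), ← setIntegral_indicator hs]
  refine setIntegral_congr_fun measurableSet_Ioi fun r hr => ?_
  have hr : 0 < r := hr
  have hr0 : (r : ℂ) ≠ 0 := by exact_mod_cast hr.ne'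
  have hnorm : ∀ ω : Metric.sphere (0 : Space m) 1, ‖r • (ω : Space m)‖ = r := by
    intro ω
    rw [norm_smul]; simp [abs_of_pos hr]
  by_cases hrs : r ∈ s
  · have h1 : ∀ ω : Metric.sphere (0 : Space m) 1,
        {z : Space m | ‖z‖ ∈ s}.indicator
          (fun z => (((‖z‖ : ℝ) : ℂ) ^ (-2 * β - m - 1) * φ z) • cvec z) (r • (ω : Space m)) =
        ((r : ℂ) ^ (-2 * β - m)) • (radialDeriv 0 φ r ω • cvec (ω : Space m)) := by
      intro ω
      rw [indicator_of_mem (by rwa [mem_ofPred_eq, hnorm]), hnorm, cvec_smul, smul_smul,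
        radialDeriv_zero, smul_smul]
      congr 1
      have : (r : ℂ) ^ (-2 * β - m) = (r : ℂ) ^ (-2 * β - m - 1) * r := by
        nth_rw 3 [← Complex.cpow_one (r : ℂ)]
        rw [← Complex.cpow_add _ _ hr0]
        congr 1
        ring
      rw [this]
      ring
    simp_rw [h1]
    rw [integral_smul, indicator_of_mem hrs]
    change _ • (_ • sphMoment 0 φ r) = _
    ext j
    simp only [Pi.smul_apply, smul_eq_mul, Complex.real_smul, finrank_euclideanSpace,
      Fintype.card_fin]
    rw [← mul_assoc]
    congr 1
    rw [Complex.ofReal_pow, ← Complex.cpow_natCast, ← Complex.cpow_add _ _ hr0]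
    congr 1
    rw [Nat.cast_sub hm]
    push_cast
    ring
  · rw [indicator_of_notMem hrs]
    have h1 : ∀ ω : Metric.sphere (0 : Space m) 1,
        {z : Space m | ‖z‖ ∈ s}.indicator
          (fun z => (((‖z‖ : ℝ) : ℂ) ^ (-2 * β - m - 1) * φ z) • cvec z) (r • (ω : Space m)) =
        0 := fun ω => indicator_of_notMem (by rwa [mem_ofPred_eq, hnorm]) _
    simp_rw [h1]
    simp

theorem outerPart_eq (hm : 1 ≤ m) (β : ℂ) (φ : 𝓢(Space m, ℂ)) :
    ∫ r in Ioi (1 : ℝ), ((r : ℂ) ^ (-2 * β - 1)) • sphMoment 0 φ r = outerPart β φ := by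
  have h := setIntegral_cpow_smul_cvec hm β φ measurableSet_Ioi
    (s := Ioi 1) (outerPart_integrableOn β φ)
  rw [inter_eq_self_of_subset_right (Ioi_subset_Ioi zero_le_one)] at h
  exact h.symm

theorem finitePart_smul {V : Type*} [NormedAddCommGroup V] [NormedSpace ℂ V] (μ c : ℂ)
    {ψ : ℝ → V} (hψ : ContDiff ℝ (⊤ : ℕ∞) ψ) :
    finitePart μ (c • ψ) = c • finitePart μ ψ := by
  have h1 : ∀ k : ℕ, iteratedDeriv k (c • ψ) 0 = c • iteratedDeriv k ψ 0 := fun k =>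
    iteratedDeriv_const_smul (hψ.of_le (mod_cast le_top)).contDiffAt c
  unfold finitePart
  simp_rw [h1, smul_add, Finset.smul_sum, ← integral_smul, Pi.smul_apply]
  congr 1
  · congr 1
    · congr 1
      ext r
      rw [smul_comm c]
      congr 1
      rw [smul_sub, Finset.smul_sum]
      exact congrArg _ (Finset.sum_congr rfl fun k _ => smul_comm _ _ _)
    · simp_rw [smul_comm c]
  · refine Finset.sum_congr rfl fun k _ => ?_
    split_ifs
    · simp
    · rw [smul_comm]

/-- The number of subtracted Taylor terms may exceed the minimal one of the definition: each extra
term leaves the integral and reappears in the finite sum. A larger `n` can then serve a whole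
neighbourhood of parameters. -/
theorem finitePart_sphMoment (hm : 1 ≤ m) {n : ℕ} {β : ℂ} (hn : 2 * β.re + 1 ≤ n)
    (φ : 𝓢(Space m, ℂ)) :
    finitePart (-2 * β - 1) (sphMoment 0 φ) = innerPart n β φ + outerPart β φ +
      ∑ k ∈ Finset.range n,
        if (k : ℂ) - 2 * β = 0 then 0
        else (1 / ((k.factorial : ℂ) * (k - 2 * β))) • sphMoment k φ 0 := by
  have hre : -(-2 * β - 1).re = 2 * β.re + 1 := by simp; ring
  have h1 : ∀ k : ℕ, -2 * β - 1 + k + 1 = (k : ℂ) - 2 * β := fun k => by ring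
  unfold finitePart
  simp_rw [hre, iteratedDeriv_sphMoment, h1, outerPart_eq hm]
  obtain ⟨d, rfl⟩ := Nat.exists_eq_add_of_le (Nat.ceil_le.2 hn)
  set n₀ := ⌈2 * β.re + 1⌉₊
  have hn₀ : 2 * β.re + 1 ≤ n₀ := Nat.le_ceil _
  have h2 : ∑ k ∈ Finset.Ico n₀ (n₀ + d), (1 / ((k.factorial : ℂ) * (k - 2 * β))) • sphMoment k φ 0
      = ∑ k ∈ Finset.Ico n₀ (n₀ + d), if (k : ℂ) - 2 * β = 0 then 0
        else (1 / ((k.factorial : ℂ) * (k - 2 * β))) • sphMoment k φ 0 := by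
    refine Finset.sum_congr rfl fun k hk => ?_
    -- The extra indices satisfy `k ≥ 2 Re β + 1`, so none of them is the resonant index.
    rw [if_neg]
    intro h0
    have h3 := congrArg Complex.re h0
    have h4 : (n₀ : ℝ) ≤ k := by exact_mod_cast (Finset.mem_Ico.1 hk).1
    simp at h3
    linarith
  have h3 := innerPart_eq_add_sum (n := n₀) (β := β) (by linarith) φ d
  rw [h2] at h3
  rw [← Finset.sum_range_add_sum_Ico _ (Nat.le_add_right n₀ d)]
  change innerPart n₀ β φ + _ + _ = _
  rw [h3]
  abel

theorem sum_range_two_mul_sphMoment (c : ℕ → ℂ) (N : ℕ) (φ : 𝓢(Space m, ℂ)) :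
    ∑ k ∈ Finset.range (2 * N), c k • sphMoment k φ 0 =
      ∑ l ∈ Finset.range N, c (2 * l + 1) • sphMoment (2 * l + 1) φ 0 := by
  induction N with
  | zero => simp
  | succ N ih =>
    rw [show 2 * (N + 1) = 2 * N + 1 + 1 by ring, Finset.sum_range_succ, Finset.sum_range_succ, ih,
      Finset.sum_range_succ, sphMoment_zero_of_even (2 * N) φ (even_two_mul N)]
    simp

theorem inv_Gamma_eq_prod (l : ℕ) (β : ℂ) :
    (Complex.Gamma (1 / 2 - β))⁻¹ =
      (∏ i ∈ Finset.range l, ((i : ℂ) + 1 / 2 - β)) * (Complex.Gamma (l + 1 / 2 - β))⁻¹ := by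
  induction l with
  | zero => simp
  | succ l ih =>
    rw [ih, Finset.prod_range_succ, Complex.one_div_Gamma_eq_self_mul_one_div_Gamma_add_one]
    push_cast
    rw [show (l : ℂ) + 1 / 2 - β + 1 = l + 1 + 1 / 2 - β by ring]
    ring

/-- The last factor `l + 1/2 - β` split off from `1/Γ(1/2 - β)` is half of `2l + 1 - 2β`: the simple
zero cancels the simple pole. -/
theorem taylorCoeff_eq {l : ℕ} {β : ℂ} (h : (2 * l + 1 : ℂ) - 2 * β ≠ 0) :
    taylorCoeff l β = (Complex.Gamma (1 / 2 - β))⁻¹ / (2 * l + 1 - 2 * β) := by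
  rw [inv_Gamma_eq_prod (l + 1), Finset.prod_range_succ, taylorCoeff, eq_div_iff h]
  push_cast
  rw [show (l : ℂ) + 3 / 2 - β = l + 1 + 1 / 2 - β by ring]
  ring

/-- Away from the exceptional parameters, `kernelVec` is the normalized finite part. -/
theorem kernelVec_eq_smul_sum (N : ℕ) {β : ℂ} (h : ∀ l : ℕ, (2 * l + 1 : ℂ) - 2 * β ≠ 0)
    (φ : 𝓢(Space m, ℂ)) :
    kernelVec N β φ = (kernelConst m β * (Complex.Gamma (1 / 2 - β))⁻¹) •
      (innerPart (2 * N) β φ + outerPart β φ + ∑ k ∈ Finset.range (2 * N),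
        (1 / ((k.factorial : ℂ) * (k - 2 * β))) • sphMoment k φ 0) := by
  rw [kernelVec, mul_smul, smul_add _ (innerPart _ _ _ + _)]
  congr 2
  rw [sum_range_two_mul_sphMoment (fun k => 1 / ((k.factorial : ℂ) * (k - 2 * β))),
    Finset.smul_sum]
  refine Finset.sum_congr rfl fun l _ => ?_
  rw [smul_smul, taylorCoeff_eq (h l)]
  congr 1
  have := h l
  have : ((2 * l + 1).factorial : ℂ) ≠ 0 := by exact_mod_cast (Nat.factorial_ne_zero _)
  push_cast
  field_simp

theorem sphereArea_ne_zero (hm : 1 ≤ m) : sphereArea m ≠ 0 := by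
  unfold sphereArea
  have hm' : (0 : ℝ) < m := by exact_mod_cast hm
  have := Real.Gamma_pos_of_pos (s := (m : ℝ) / 2) (by positivity)
  have := Real.pi_pos
  positivity

theorem U_eq (hm : 1 ≤ m) (β : ℂ) (φ : 𝓢(Space m, ℂ)) :
    U m (-m - 2 * β) φ =
      CliffordAlgebra.ι (negForm m) (finitePart (-2 * β - 1) (sphMoment 0 φ)) := by
  unfold U
  have h : (sphereArea m : ℂ) ≠ 0 := by exact_mod_cast sphereArea_ne_zero hm
  rw [sphericalMean_eq, finitePart_smul _ _ (contDiff_sphMoment φ), smul_smul]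
  push_cast
  rw [mul_one_div_cancel h, one_smul]
  congr 2
  ring

/-- Away from `β = l + 1/2` the distribution is the normalized finite part, and only the powers of
`π` remain to be compared: `π^{1/2-β} / π^{(m-2β+1)/2} = π^{-m/2}`. -/
theorem laplaceH_eq_kernelVec (hm : 1 ≤ m) {N : ℕ} {β : ℂ} (hN : 2 * β.re + 1 ≤ 2 * N)
    (h : ∀ l : ℕ, (2 * l + 1 : ℂ) - 2 * β ≠ 0) (φ : 𝓢(Space m, ℂ)) :
    laplaceH m β φ = CliffordAlgebra.ι (negForm m) (kernelVec N β φ) := by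
  have hex : ¬ ∃ l : ℕ, -(m : ℂ) - 2 * β = -m - 2 * l - 1 := by
    rintro ⟨l, hl⟩
    exact h l (by linear_combination hl)
  -- The finite part omits the index `k = 2β`; on the other side the same term is zero because `1 /
  -- 0 = 0`.
  have hsum : ∑ k ∈ Finset.range (2 * N), (if (k : ℂ) - 2 * β = 0 then 0
        else (1 / ((k.factorial : ℂ) * (k - 2 * β))) • sphMoment k φ 0) =
      ∑ k ∈ Finset.range (2 * N), (1 / ((k.factorial : ℂ) * (k - 2 * β))) • sphMoment k φ 0 := by
    refine Finset.sum_congr rfl fun k _ => ?_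
    split_ifs with h0
    · rw [h0]; simp
    · rfl
  rw [laplaceH, UStar, dif_neg hex, U_eq hm, finitePart_sphMoment hm (n := 2 * N)
    (by push_cast; linarith), kernelVec_eq_smul_sum N h, smul_smul, map_smul, hsum]
  congr 1
  have hpi : (Real.pi : ℂ) ≠ 0 := by exact_mod_cast Real.pi_ne_zero
  rw [show (-(m : ℂ) - 2 * β + m + 1) / 2 = 1 / 2 - β by ring, kernelConst]
  have h1 : (Real.pi : ℂ) ^ (-(m : ℂ) / 2) =
      (Real.pi : ℂ) ^ (1 / 2 - β) / (Real.pi : ℂ) ^ (((m : ℂ) - 2 * β + 1) / 2) := by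
    rw [← Complex.cpow_sub _ _ hpi]
    congr 1
    ring
  rw [h1]
  ring

/-! ### Derivatives of reflected and translated test functions -/

theorem iteratedFDeriv_reflectAt (k : ℕ) (φ : 𝓢(Space m, ℂ)) (y x v : Space m) :
    iteratedFDeriv ℝ k (reflectAt y φ) x (fun _ => v) =
      iteratedFDeriv ℝ k φ (y - x) (fun _ => -v) := by
  have h1 : (⇑(reflectAt y φ) : Space m → ℂ) =
      (fun w => φ (y + w)) ∘ (-ContinuousLinearMap.id ℝ (Space m)) := by
    ext z; simp [reflectAt_apply, sub_eq_add_neg]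
  have h2 : ContDiff ℝ (⊤ : ℕ∞) fun w => φ (y + w) :=
    (φ.smooth ⊤).comp (contDiff_const.add contDiff_id)
  rw [h1, ContinuousLinearMap.iteratedFDeriv_comp_right _ h2 x (mod_cast le_top)]
  simp [iteratedFDeriv_comp_add_left, sub_eq_add_neg]

theorem norm_iteratedFDeriv_reflectAt (k : ℕ) (φ : 𝓢(Space m, ℂ)) (y x : Space m) :
    ‖iteratedFDeriv ℝ k (reflectAt y φ) x‖ = ‖iteratedFDeriv ℝ k φ (y - x)‖ := by
  have h1 : (⇑(reflectAt y φ) : Space m → ℂ) =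
      (fun w => φ (y + w)) ∘ (LinearIsometryEquiv.neg ℝ (E := Space m)) := by
    ext z; simp [reflectAt_apply, sub_eq_add_neg]
  rw [h1, LinearIsometryEquiv.norm_iteratedFDeriv_comp_right]
  simp [iteratedFDeriv_comp_add_left, sub_eq_add_neg]

theorem radialDeriv_reflectAt (k : ℕ) (φ : 𝓢(Space m, ℂ)) (y : Space m) (r : ℝ) (ω : Space m) :
    radialDeriv k (reflectAt y φ) r ω = iteratedFDeriv ℝ k φ (y - r • ω) (fun _ => -ω) :=
  iteratedFDeriv_reflectAt k φ y _ _

/-! ### Holomorphy of the kernel in the parameter -/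

section Holomorphy

theorem differentiableAt_innerPart {n : ℕ} {β₀ : ℂ} (h : 2 * β₀.re < n) (φ : 𝓢(Space m, ℂ)) :
    DifferentiableAt ℂ (fun β => innerPart n β φ) β₀ := by
  obtain ⟨C, hC⟩ := exists_bound_iteratedFDeriv n φ
  have hC0 : 0 ≤ C := (norm_nonneg _).trans (hC 0)
  -- This makes the exponent `n - 2(Re β₀ + ε) - 1` of the dominating function equal to `2ε - 1 >
  -- -1`.
  set ε : ℝ := ((n : ℝ) - 2 * β₀.re) / 4 with hε
  have hε0 : 0 < ε := by rw [hε]; linarith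
  refine differentiableAt_integral_of_norm_le hε0
    (F := fun β (r : ℝ) => ((r : ℂ) ^ (-2 * β - 1)) • sphRemainder n φ r)
    (bound := fun r : ℝ => C * (sphereMeasure m).real univ * r ^ ((n : ℝ) - 2 * (β₀.re + ε) - 1))
    (fun β _ => aestronglyMeasurable_innerIntegrand n β φ) ?_ ?_
    ((integrableOn_rpow_Ioc (by linarith)).const_mul _)
  · filter_upwards [ae_restrict_mem measurableSet_Ioc] with r hr β _
    have hr0 : (r : ℂ) ≠ 0 := by exact_mod_cast hr.1.ne'
    exact (DifferentiableAt.const_cpow (by fun_prop) (Or.inl hr0)).smul_const _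
  · filter_upwards [ae_restrict_mem measurableSet_Ioc] with r hr β hβ
    refine (norm_innerIntegrand_le φ (fun x _ => hC x) hr).trans ?_
    have h1 : |β.re - β₀.re| < ε := by
      have := Complex.abs_re_le_norm (β - β₀)
      rw [Complex.sub_re] at this
      exact this.trans_lt (mem_ball_iff_norm.1 hβ)
    have h2 := (abs_lt.1 h1).2
    gcongr 1
    exact Real.rpow_le_rpow_of_exponent_ge hr.1 hr.2 (by linarith)

theorem norm_outerIntegrand_le {β : ℂ} (φ : 𝓢(Space m, ℂ)) {p : ℝ} (hp : -2 * β.re - m ≤ p)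
    {z : Space m} (hz : 1 < ‖z‖) :
    ‖(((‖z‖ : ℝ) : ℂ) ^ (-2 * β - m - 1) * φ z) • cvec z‖ ≤ ‖z‖ ^ p * ‖φ z‖ := by
  have hz0 : 0 < ‖z‖ := by linarith
  rw [norm_smul, norm_mul, Complex.norm_cpow_eq_rpow_re_of_pos hz0]
  have h1 : ‖z‖ ^ (-2 * β - m - 1).re * ‖z‖ ≤ ‖z‖ ^ p := by
    nth_rw 2 [← Real.rpow_one ‖z‖]
    rw [← Real.rpow_add hz0]
    refine Real.rpow_le_rpow_of_exponent_le hz.le ?_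
    simp
    linarith
  calc _ ≤ ‖z‖ ^ (-2 * β - m - 1).re * ‖φ z‖ * ‖z‖ := by
        gcongr; exact norm_cvec_le z
    _ = ‖z‖ ^ (-2 * β - m - 1).re * ‖z‖ * ‖φ z‖ := by ring
    _ ≤ _ := by gcongr

theorem measurableSet_one_lt_norm : MeasurableSet {z : Space m | 1 < ‖z‖} :=
  measurableSet_lt measurable_const measurable_norm

theorem differentiableAt_outerPart (β₀ : ℂ) (φ : 𝓢(Space m, ℂ)) :
    DifferentiableAt ℂ (fun β => outerPart β φ) β₀ := by
  obtain ⟨k, hk⟩ := exists_nat_ge (-2 * (β₀.re - 1) - m)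
  refine differentiableAt_integral_of_norm_le one_pos
    (F := fun β z => (((‖z‖ : ℝ) : ℂ) ^ (-2 * β - m - 1) * φ z) • cvec z)
    (bound := fun z => ‖z‖ ^ k * ‖φ z‖)
    (fun β _ => (outerPart_integrableOn β φ).1) ?_ ?_
    (φ.integrable_pow_mul volume k).integrableOn
  · filter_upwards [ae_restrict_mem measurableSet_one_lt_norm] with z hz β _
    have hz : 1 < ‖z‖ := hz
    have hz0 : ((‖z‖ : ℝ) : ℂ) ≠ 0 := by
      have : ‖z‖ ≠ 0 := by linarith
      exact_mod_cast this
    exact ((DifferentiableAt.const_cpow (by fun_prop) (Or.inl hz0)).mul_const _).smul_const _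
  · filter_upwards [ae_restrict_mem measurableSet_one_lt_norm] with z hz β hβ
    rw [← Real.rpow_natCast]
    refine norm_outerIntegrand_le φ ?_ hz
    have h1 : |β.re - β₀.re| < 1 := by
      have := Complex.abs_re_le_norm (β - β₀)
      rw [Complex.sub_re] at this
      exact this.trans_lt (mem_ball_iff_norm.1 hβ)
    have h2 := (abs_lt.1 h1).1
    linarith

theorem differentiable_taylorCoeff (l : ℕ) : Differentiable ℂ (taylorCoeff l) := by
  unfold taylorCoeff
  have h1 : Differentiable ℂ fun β : ℂ => (Complex.Gamma (l + 3 / 2 - β))⁻¹ :=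
    Complex.differentiable_one_div_Gamma.comp (by fun_prop :
      Differentiable ℂ fun β : ℂ => (l : ℂ) + 3 / 2 - β)
  have h2 : Differentiable ℂ fun β : ℂ => ∏ i ∈ Finset.range l, ((i : ℂ) + 1 / 2 - β) := by
    fun_prop
  exact (h2.div_const 2).mul h1

theorem differentiable_inv_Gamma_half_sub :
    Differentiable ℂ fun β : ℂ => (Complex.Gamma (1 / 2 - β))⁻¹ :=
  Complex.differentiable_one_div_Gamma.comp (by fun_prop :
      Differentiable ℂ fun β : ℂ => 1 / 2 - β)

/-- The excluded parameters are exactly the poles of `Γ((m+2β+1)/2)`, the only singularities of the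
construction. -/
theorem differentiableAt_kernelConst {β : ℂ} (h : ∀ n : ℕ, β ≠ -(((m : ℂ) + 1) / 2 + n)) :
    DifferentiableAt ℂ (kernelConst m) β := by
  unfold kernelConst
  have h1 : DifferentiableAt ℂ (fun β : ℂ => Complex.Gamma ((m + 2 * β + 1) / 2)) β := by
    refine DifferentiableAt.fun_comp' (g := Complex.Gamma) β
      (Complex.differentiableAt_Gamma _ fun n hn => h n ?_) (by fun_prop)
    linear_combination hn
  have h2 : DifferentiableAt ℂ (fun β : ℂ => (2 : ℂ) ^ (2 * β)) β :=
    DifferentiableAt.const_cpow (by fun_prop) (Or.inl two_ne_zero)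
  fun_prop

theorem differentiableAt_kernelVec {N : ℕ} {β : ℂ} (hN : β.re < N)
    (h : ∀ n : ℕ, β ≠ -(((m : ℂ) + 1) / 2 + n)) (φ : 𝓢(Space m, ℂ)) :
    DifferentiableAt ℂ (fun β => kernelVec N β φ) β := by
  unfold kernelVec
  refine (differentiableAt_kernelConst h).smul (DifferentiableAt.add
    ((differentiable_inv_Gamma_half_sub β).smul
      ((differentiableAt_innerPart (by push_cast; linarith) φ).add
        (differentiableAt_outerPart β φ))) ?_)
  refine DifferentiableAt.fun_sum fun l _ => ?_
  exact ((differentiable_taylorCoeff l β).div_const _).smul_const _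

end Holomorphy

/-! ### Decay of the regularized kernel at infinity -/

section Decay

theorem one_add_norm_le_mul (y z : Space m) : 1 + ‖y‖ ≤ (1 + ‖z‖) * (1 + ‖y - z‖) := by
  have h := norm_add_le z (y - z)
  rw [add_sub_cancel] at h
  nlinarith [norm_nonneg z, norm_nonneg (y - z)]

theorem one_add_norm_le_mul' (y z : Space m) : 1 + ‖z‖ ≤ (1 + ‖y‖) * (1 + ‖y - z‖) := by
  have h := norm_sub_le y (y - z)
  rw [sub_sub_cancel] at h
  nlinarith [norm_nonneg y, norm_nonneg (y - z)]

/-- Peetre's inequality. -/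
theorem rpow_norm_le (p : ℝ) {y z : Space m} (hz : 1 < ‖z‖) :
    ‖z‖ ^ p ≤ 2 ^ |p| * (1 + ‖y‖) ^ p * (1 + ‖y - z‖) ^ |p| := by
  have hz0 : 0 < ‖z‖ := by linarith
  have hy0 : 0 < 1 + ‖y‖ := by positivity
  have hw0 : 0 < 1 + ‖y - z‖ := by positivity
  rcases le_total 0 p with hp | hp
  · rw [abs_of_nonneg hp]
    have h2 : (1 : ℝ) ≤ 2 ^ p := Real.one_le_rpow one_le_two hp
    calc ‖z‖ ^ p ≤ ((1 + ‖y‖) * (1 + ‖y - z‖)) ^ p :=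
          Real.rpow_le_rpow hz0.le (by linarith [one_add_norm_le_mul' y z]) hp
      _ = 1 * ((1 + ‖y‖) ^ p * (1 + ‖y - z‖) ^ p) := by
          rw [Real.mul_rpow hy0.le hw0.le, one_mul]
      _ ≤ 2 ^ p * ((1 + ‖y‖) ^ p * (1 + ‖y - z‖) ^ p) := by gcongr
      _ = _ := by ring
  · rw [abs_of_nonpos hp]
    -- For negative exponents a lower bound on `‖z‖` is needed; the factor `2` comes from `1 + ‖z‖ ≤
    -- 2‖z‖`, valid as `‖z‖ > 1`.
    have h1 : (1 + ‖y‖) / (2 * (1 + ‖y - z‖)) ≤ ‖z‖ := by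
      rw [div_le_iff₀ (by positivity)]
      have := one_add_norm_le_mul y z
      nlinarith
    calc ‖z‖ ^ p ≤ ((1 + ‖y‖) / (2 * (1 + ‖y - z‖))) ^ p :=
          Real.rpow_le_rpow_of_nonpos (by positivity) h1 hp
      _ = (1 + ‖y‖) ^ p / (2 ^ p * (1 + ‖y - z‖) ^ p) := by
          rw [Real.div_rpow hy0.le (by positivity), Real.mul_rpow zero_le_two hw0.le]
      _ = _ := by
          rw [Real.rpow_neg zero_le_two, Real.rpow_neg hw0.le]
          field_simp

/-- For `x` in the unit ball, `y - x` is comparable to `y`, so Schwartz decay beats any power,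
however negative `p` is. The local terms of the kernel therefore never limit its decay. -/
theorem exists_norm_iteratedFDeriv_le_rpow (k : ℕ) (φ : 𝓢(Space m, ℂ)) (p : ℝ) :
    ∃ C, 0 ≤ C ∧ ∀ y x : Space m, ‖x‖ ≤ 1 →
      ‖iteratedFDeriv ℝ k (reflectAt y φ) x‖ ≤ C * (1 + ‖y‖) ^ p := by
  obtain ⟨M, hM⟩ := exists_nat_ge (-p)
  set C := 2 ^ M * (Finset.Iic (M, k)).sup (fun m => SchwartzMap.seminorm ℝ m.1 m.2) φ
  refine ⟨2 ^ M * C, by positivity, fun y x hx => ?_⟩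
  rw [norm_iteratedFDeriv_reflectAt]
  have h := φ.one_add_le_sup_seminorm_apply (𝕜 := ℝ) (m := (M, k)) le_rfl le_rfl (y - x)
  have h1 : 1 + ‖y‖ ≤ 2 * (1 + ‖y - x‖) := by
    have := one_add_norm_le_mul y x
    nlinarith [norm_nonneg (y - x)]
  have h2 : (1 + ‖y‖) ^ M ≤ 2 ^ M * (1 + ‖y - x‖) ^ M := by
    rw [← mul_pow]; gcongr
  have hy : 0 < (1 + ‖y‖) ^ M := by positivity
  have h3 : ((1 + ‖y‖) ^ M)⁻¹ ≤ (1 + ‖y‖) ^ p := by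
    rw [← Real.rpow_natCast, ← Real.rpow_neg (by positivity)]
    exact Real.rpow_le_rpow_of_exponent_le (by linarith [norm_nonneg y]) (by linarith)
  have h4 : (1 + ‖y‖) ^ M * ‖iteratedFDeriv ℝ k φ (y - x)‖ ≤ 2 ^ M * C := by
    calc _ ≤ 2 ^ M * (1 + ‖y - x‖) ^ M * ‖iteratedFDeriv ℝ k φ (y - x)‖ := by gcongr
      _ = 2 ^ M * ((1 + ‖y - x‖) ^ M * ‖iteratedFDeriv ℝ k φ (y - x)‖) := by ring
      _ ≤ _ := by gcongr
  calc _ ≤ 2 ^ M * C * ((1 + ‖y‖) ^ M)⁻¹ := by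
        rw [← div_eq_mul_inv, le_div_iff₀ hy]; linarith
    _ ≤ _ := by gcongr

theorem exists_norm_sphMoment_le_rpow (k : ℕ) (φ : 𝓢(Space m, ℂ)) (p : ℝ) :
    ∃ C, 0 ≤ C ∧ ∀ y : Space m, ‖sphMoment k (reflectAt y φ) 0‖ ≤ C * (1 + ‖y‖) ^ p := by
  obtain ⟨C, hC0, hC⟩ := exists_norm_iteratedFDeriv_le_rpow k φ p
  refine ⟨C * (sphereMeasure m).real univ, by positivity, fun y => ?_⟩
  refine (norm_sphMoment_le k _ 0 fun ω hω => hC y (0 • ω) (by simp)).trans_eq (by ring)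

/-- Requiring `2 Re β + 1 ≤ n` rather than `2 Re β < n` keeps `1/(n - 2 Re β)` at most `1`, so the
constant is uniform in `β`. -/
theorem exists_norm_innerPart_le_rpow (n : ℕ) (φ : 𝓢(Space m, ℂ)) (p : ℝ) :
    ∃ C, 0 ≤ C ∧ ∀ β : ℂ, 2 * β.re + 1 ≤ n → ∀ y : Space m,
      ‖innerPart n β (reflectAt y φ)‖ ≤ C * (1 + ‖y‖) ^ p := by
  obtain ⟨C, hC0, hC⟩ := exists_norm_iteratedFDeriv_le_rpow n φ p
  refine ⟨C * (sphereMeasure m).real univ, by positivity, fun β hβ y => ?_⟩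
  refine (norm_innerPart_le (by linarith) _ (hC y)).trans ((div_le_self ?_ (by linarith)).trans_eq
    (by ring))
  positivity

/-- Peetre's inequality moves the power of `‖z‖` onto `y`, and the loss `(1 + ‖y - z‖)^|p|` is
absorbed by the test function. This term fixes the decay rate of the kernel. -/
theorem exists_norm_outerPart_le_rpow (φ : 𝓢(Space m, ℂ)) (p : ℝ) :
    ∃ C, 0 ≤ C ∧ ∀ β : ℂ, -2 * β.re - m ≤ p → ∀ y : Space m,
      ‖outerPart β (reflectAt y φ)‖ ≤ C * (1 + ‖y‖) ^ p := by
  obtain ⟨k, hk⟩ := exists_nat_ge |p|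
  have hint : Integrable fun w : Space m => (1 + ‖w‖) ^ k * ‖φ w‖ := by
    have h1 := fun i (_ : i ∈ Finset.range (k + 1)) =>
      (φ.integrable_pow_mul volume i).const_mul ((k.choose i : ℝ))
    refine (integrable_finsetSum _ h1).congr (Eventually.of_forall fun w => ?_)
    simp only
    rw [add_comm 1 ‖w‖, add_pow, Finset.sum_mul]
    refine Finset.sum_congr rfl fun i _ => ?_
    rw [one_pow]
    ring
  refine ⟨2 ^ |p| * ∫ w : Space m, (1 + ‖w‖) ^ k * ‖φ w‖, ?_, fun β hβ y => ?_⟩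
  · have : 0 ≤ ∫ w : Space m, (1 + ‖w‖) ^ k * ‖φ w‖ := integral_nonneg fun w => by positivity
    positivity
  have hint2 : Integrable fun z : Space m =>
      2 ^ |p| * (1 + ‖y‖) ^ p * ((1 + ‖y - z‖) ^ k * ‖φ (y - z)‖) :=
    ((integrable_comp_sub_left (fun w : Space m => (1 + ‖w‖) ^ k * ‖φ w‖) y).2 hint).const_mul _
  unfold outerPart
  refine (norm_integral_le_of_norm_le hint2.integrableOn ?_).trans
    ((setIntegral_le_integral hint2 (Eventually.of_forall fun z => ?_)).trans_eq ?_)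
  · filter_upwards [ae_restrict_mem measurableSet_one_lt_norm] with z hz
    refine (norm_outerIntegrand_le _ hβ hz).trans ?_
    rw [reflectAt_apply, ← mul_assoc]
    gcongr
    refine (rpow_norm_le p (y := y) hz).trans ?_
    gcongr
    rw [← Real.rpow_natCast]
    exact Real.rpow_le_rpow_of_exponent_le (by linarith [norm_nonneg (y - z)]) hk
  · simp only [Pi.zero_apply]; positivity
  · rw [integral_const_mul, integral_sub_left_eq_self (fun w : Space m => (1 + ‖w‖) ^ k * ‖φ w‖)]
    ring

/-- The rate is `-2 Re β - m`; the strict inequality for `p` leaves room for one bound on a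
neighbourhood of `β₀`, as domination in `β` requires. -/
theorem exists_norm_kernelVec_le_rpow {N : ℕ} {β₀ : ℂ} (hN : 2 * β₀.re + 1 < 2 * N)
    (h : ∀ n : ℕ, β₀ ≠ -(((m : ℂ) + 1) / 2 + n)) (φ : 𝓢(Space m, ℂ)) {p : ℝ}
    (hp : -2 * β₀.re - m < p) :
    ∃ C, 0 ≤ C ∧ ∀ᶠ β in 𝓝 β₀, ∀ y : Space m,
      ‖kernelVec N β (reflectAt y φ)‖ ≤ C * (1 + ‖y‖) ^ p := by
  obtain ⟨C₁, hC₁, h₁⟩ := exists_norm_innerPart_le_rpow (2 * N) φ p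
  obtain ⟨C₂, hC₂, h₂⟩ := exists_norm_outerPart_le_rpow φ p
  choose C₃ hC₃ h₃ using fun k => exists_norm_sphMoment_le_rpow k φ p
  let B : ℂ → ℝ := fun β => ‖kernelConst m β‖ * (‖(Complex.Gamma (1 / 2 - β))⁻¹‖ * (C₁ + C₂) +
    ∑ l ∈ Finset.range N, ‖taylorCoeff l β / ((2 * l + 1).factorial : ℂ)‖ * C₃ (2 * l + 1))
  have hB : ContinuousAt B β₀ := by
    have h1 := (differentiableAt_kernelConst h).continuousAt.norm
    have h2 := (differentiable_inv_Gamma_half_sub β₀).continuousAt.norm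
    have h3 : ContinuousAt (fun β => ∑ l ∈ Finset.range N,
        ‖taylorCoeff l β / ((2 * l + 1).factorial : ℂ)‖ * C₃ (2 * l + 1)) β₀ := by
      refine (continuous_finsetSum _ fun l _ => ?_).continuousAt
      exact (((differentiable_taylorCoeff l).continuous.div_const _).norm).mul_const _
    exact h1.mul ((h2.mul_const _).add h3)
  have hre : ContinuousAt Complex.re β₀ := Complex.continuous_re.continuousAt
  -- `B` is continuous at `β₀`, hence stays below `B β₀ + 1` nearby; the absolute value only
  -- supplies nonnegativity.
  refine ⟨|B β₀ + 1|, abs_nonneg _, ?_⟩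
  filter_upwards [hB.eventually (gt_mem_nhds (lt_add_one _)),
    (continuousAt_const.mul hre).add_const 1 |>.eventually (gt_mem_nhds hN),
    ((continuousAt_const.mul hre).sub_const (m : ℝ)).eventually (gt_mem_nhds hp)] with β hβ1 hβ2 hβ3 y
  change 2 * β.re + 1 < 2 * N at hβ2
  change -2 * β.re - m < p at hβ3
  have hle : ‖kernelVec N β (reflectAt y φ)‖ ≤ B β * (1 + ‖y‖) ^ p := by
    unfold kernelVec
    rw [norm_smul, mul_assoc]
    gcongr
    rw [add_mul]
    refine (norm_add_le _ _).trans (add_le_add ?_ ?_)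
    · rw [norm_smul, mul_assoc, add_mul]
      gcongr
      exact (norm_add_le _ _).trans (add_le_add (h₁ β (by push_cast; linarith) y)
        (h₂ β hβ3.le y))
    · rw [Finset.sum_mul]
      refine (norm_sum_le _ _).trans (Finset.sum_le_sum fun l _ => ?_)
      rw [norm_smul, mul_assoc]
      gcongr
      exact h₃ _ y
  refine hle.trans ?_
  gcongr
  exact hβ1.le.trans (le_abs_self _)

end Decay

/-! ### Measurability of the regularized kernel -/

section Measurability

theorem stronglyMeasurable_sphMoment_reflectAt (k : ℕ) (φ : 𝓢(Space m, ℂ)) :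
    StronglyMeasurable fun p : Space m × ℝ => sphMoment k (reflectAt p.1 φ) p.2 := by
  unfold sphMoment
  simp_rw [radialDeriv_reflectAt]
  refine StronglyMeasurable.integral_prod_right
    (f := fun (p : Space m × ℝ) (ω : Metric.sphere (0 : Space m) 1) =>
      (iteratedFDeriv ℝ k φ (p.1 - p.2 • (ω : Space m)) fun _ => -(ω : Space m)) •
        cvec (ω : Space m)) (Continuous.stronglyMeasurable ?_)
  have h1 : Continuous fun q : (Space m × ℝ) × Metric.sphere (0 : Space m) 1 =>
      iteratedFDeriv ℝ k φ (q.1.1 - q.1.2 • (q.2 : Space m)) :=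
    (continuous_iteratedFDeriv_schwartz k φ).comp (by fun_prop)
  have h2 : Continuous fun q : (Space m × ℝ) × Metric.sphere (0 : Space m) 1 =>
      cvec (q.2 : Space m) := continuous_cvec.comp (by fun_prop)
  simp only [Function.uncurry_def]
  fun_prop

theorem stronglyMeasurable_innerPart_reflectAt (n : ℕ) (β : ℂ) (φ : 𝓢(Space m, ℂ)) :
    StronglyMeasurable fun y : Space m => innerPart n β (reflectAt y φ) := by
  unfold innerPart sphRemainder
  refine StronglyMeasurable.integral_prod_right
    (f := fun (y : Space m) (r : ℝ) => ((r : ℂ) ^ (-2 * β - 1)) •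
      (sphMoment 0 (reflectAt y φ) r - ∑ k ∈ Finset.range n,
        ((r : ℂ) ^ k / (k.factorial : ℂ)) • sphMoment k (reflectAt y φ) 0)) ?_
  simp only [Function.uncurry_def]
  refine StronglyMeasurable.smul
    ((measurable_cpow_ofReal _).comp measurable_snd).stronglyMeasurable
    ((stronglyMeasurable_sphMoment_reflectAt 0 φ).sub
      (Finset.stronglyMeasurable_fun_sum _ fun k _ => StronglyMeasurable.smul
        (f := fun p : Space m × ℝ => (p.2 : ℂ) ^ k / (k.factorial : ℂ)) ?_ ?_))
  · exact Continuous.stronglyMeasurable (by fun_prop)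
  · exact (stronglyMeasurable_sphMoment_reflectAt k φ).comp_measurable
      (g := fun p : Space m × ℝ => (p.1, (0 : ℝ))) (by fun_prop)

theorem stronglyMeasurable_outerPart_reflectAt (β : ℂ) (φ : 𝓢(Space m, ℂ)) :
    StronglyMeasurable fun y : Space m => outerPart β (reflectAt y φ) := by
  unfold outerPart
  simp_rw [reflectAt_apply]
  refine StronglyMeasurable.integral_prod_right
    (f := fun (y : Space m) (z : Space m) =>
      (((‖z‖ : ℝ) : ℂ) ^ (-2 * β - m - 1) * φ (y - z)) • cvec z) ?_
  have h1 : Measurable fun z : Space m => ((‖z‖ : ℝ) : ℂ) ^ (-2 * β - m - 1) :=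
    (measurable_cpow_ofReal _).comp measurable_norm
  simp only [Function.uncurry_def]
  refine ((h1.comp measurable_snd).stronglyMeasurable.mul ?_).smul ?_
  · exact (φ.continuous.comp (by fun_prop)).stronglyMeasurable
  · exact (continuous_cvec.comp continuous_snd).stronglyMeasurable

theorem stronglyMeasurable_kernelVec_reflectAt (N : ℕ) (β : ℂ) (φ : 𝓢(Space m, ℂ)) :
    StronglyMeasurable fun y : Space m => kernelVec N β (reflectAt y φ) := by
  unfold kernelVec
  refine StronglyMeasurable.const_smul (StronglyMeasurable.add
    (((stronglyMeasurable_innerPart_reflectAt _ β φ).add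
      (stronglyMeasurable_outerPart_reflectAt β φ)).const_smul (Complex.Gamma (1 / 2 - β))⁻¹)
    (Finset.stronglyMeasurable_fun_sum _ fun l _ => StronglyMeasurable.const_smul ?_
      (taylorCoeff l β / ((2 * l + 1).factorial : ℂ)))) (kernelConst m β)
  exact (stronglyMeasurable_sphMoment_reflectAt _ φ).comp_measurable
    (g := fun y : Space m => (y, (0 : ℝ))) (by fun_prop)

end Measurability

/-! ### Linearity and continuity on Schwartz space -/

section Continuity

theorem innerPart_add {n : ℕ} {β : ℂ} (h : 2 * β.re < n) (φ ψ : 𝓢(Space m, ℂ)) :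
    innerPart n β (φ + ψ) = innerPart n β φ + innerPart n β ψ := by
  unfold innerPart
  rw [← integral_add (integrableOn_innerIntegrand h φ) (integrableOn_innerIntegrand h ψ)]
  congr 1
  ext1 r
  rw [← smul_add]
  congr 1
  simp only [sphRemainder, sphMoment_add, smul_add, Finset.sum_add_distrib]
  abel

theorem innerPart_smul (n : ℕ) (β c : ℂ) (φ : 𝓢(Space m, ℂ)) :
    innerPart n β (c • φ) = c • innerPart n β φ := by
  unfold innerPart
  rw [← integral_smul]
  congr 1
  ext1 r
  rw [smul_comm c]
  congr 1
  simp only [sphRemainder, sphMoment_smul, smul_sub, Finset.smul_sum, smul_comm c]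

theorem outerPart_add (β : ℂ) (φ ψ : 𝓢(Space m, ℂ)) :
    outerPart β (φ + ψ) = outerPart β φ + outerPart β ψ := by
  unfold outerPart
  rw [← integral_add (outerPart_integrableOn β φ) (outerPart_integrableOn β ψ)]
  congr 1
  ext1 r
  rw [← add_smul, ← mul_add]
  rfl

theorem outerPart_smul (β c : ℂ) (φ : 𝓢(Space m, ℂ)) :
    outerPart β (c • φ) = c • outerPart β φ := by
  unfold outerPart
  rw [← integral_smul]
  congr 1
  ext1 r
  rw [smul_smul, mul_left_comm]
  rfl

theorem kernelVec_add {N : ℕ} {β : ℂ} (h : β.re < N) (φ ψ : 𝓢(Space m, ℂ)) :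
    kernelVec N β (φ + ψ) = kernelVec N β φ + kernelVec N β ψ := by
  unfold kernelVec
  rw [innerPart_add (by push_cast; linarith), outerPart_add]
  simp only [sphMoment_add, smul_add, Finset.sum_add_distrib]
  abel

theorem kernelVec_smul (N : ℕ) (β c : ℂ) (φ : 𝓢(Space m, ℂ)) :
    kernelVec N β (c • φ) = c • kernelVec N β φ := by
  unfold kernelVec
  rw [innerPart_smul, outerPart_smul]
  simp only [sphMoment_smul, smul_add, Finset.smul_sum, smul_comm c]

/-- The two-seminorm bound has the shape of `SchwartzMap.integral_pow_mul_iteratedFDeriv_le`, so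
that the outer integral fits without rearrangement. -/
theorem continuous_of_norm_le_seminorm {V : Type*} [NormedAddCommGroup V] [NormedSpace ℂ V]
    {A : 𝓢(Space m, ℂ) → V} (hadd : ∀ φ ψ, A (φ + ψ) = A φ + A ψ)
    (hsmul : ∀ (c : ℂ) φ, A (c • φ) = c • A φ) {C : ℝ} (hC : 0 ≤ C) {k n : ℕ}
    (h : ∀ φ, ‖A φ‖ ≤ C * (SchwartzMap.seminorm ℂ 0 n φ + SchwartzMap.seminorm ℂ k n φ)) :
    Continuous A := by
  refine (SchwartzMap.mkCLMtoNormedSpace (𝕜 := ℂ) (σ := RingHom.id ℂ) A hadd hsmul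
    ⟨{(0, n), (k, n)}, C * 2, by positivity, fun φ => (h φ).trans ?_⟩).continuous
  have h1 := Seminorm.le_finset_sup_apply (p := schwartzSeminormFamily ℂ (Space m) ℂ)
    (s := {(0, n), (k, n)}) (x := φ) (i := (0, n)) (by simp)
  have h2 := Seminorm.le_finset_sup_apply (p := schwartzSeminormFamily ℂ (Space m) ℂ)
    (s := {(0, n), (k, n)}) (x := φ) (i := (k, n)) (by simp)
  rw [SchwartzMap.schwartzSeminormFamily_apply] at h1 h2
  rw [mul_assoc]
  gcongr
  linarith

theorem continuous_innerPart {n : ℕ} {β : ℂ} (h : 2 * β.re < n) :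
    Continuous fun φ : 𝓢(Space m, ℂ) => innerPart n β φ := by
  refine continuous_of_norm_le_seminorm (innerPart_add h) (innerPart_smul n β)
    (C := (sphereMeasure m).real univ / (n - 2 * β.re)) (k := 0) (n := n)
    (div_nonneg (by positivity) (by linarith)) fun φ => ?_
  refine (norm_innerPart_le h φ (fun x _ => φ.norm_iteratedFDeriv_le_seminorm ℂ n x)).trans ?_
  rw [mul_div_assoc, mul_comm]
  have h1 : 0 ≤ (sphereMeasure m).real univ / ((n : ℝ) - 2 * β.re) :=
    div_nonneg (by positivity) (by linarith)
  gcongr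
  exact le_add_of_nonneg_right (apply_nonneg _ _)

theorem continuous_outerPart (β : ℂ) : Continuous fun φ : 𝓢(Space m, ℂ) => outerPart β φ := by
  obtain ⟨k, hk⟩ := exists_nat_ge (-2 * β.re - m)
  refine continuous_of_norm_le_seminorm (outerPart_add β) (outerPart_smul β)
    (k := k + (volume : Measure (Space m)).integrablePower) (n := 0)
    (C := 2 ^ (volume : Measure (Space m)).integrablePower * (∫ x : Space m,
      (1 + ‖x‖) ^ (-((volume : Measure (Space m)).integrablePower : ℝ)))) ?_ fun φ => ?_
  · have : 0 ≤ ∫ x : Space m, (1 + ‖x‖) ^ (-((volume : Measure (Space m)).integrablePower : ℝ)) :=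
      integral_nonneg fun x => by positivity
    positivity
  refine le_trans ?_ (SchwartzMap.integral_pow_mul_iteratedFDeriv_le ℂ volume φ k 0)
  simp only [norm_iteratedFDeriv_zero]
  have hint := φ.integrable_pow_mul volume k
  refine (norm_integral_le_of_norm_le hint.integrableOn ?_).trans
    (setIntegral_le_integral hint (Eventually.of_forall fun z => ?_))
  · filter_upwards [ae_restrict_mem measurableSet_one_lt_norm] with z hz
    rw [← Real.rpow_natCast]
    exact norm_outerIntegrand_le φ hk hz
  · simp only [Pi.zero_apply]; positivity

theorem continuous_sphMoment_zero (k : ℕ) :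
    Continuous fun φ : 𝓢(Space m, ℂ) => sphMoment k φ 0 := by
  refine continuous_of_norm_le_seminorm (fun φ ψ => sphMoment_add k φ ψ 0)
    (fun c φ => sphMoment_smul k φ c 0)
    (C := (sphereMeasure m).real univ) (k := 0) (n := k) (by positivity) fun φ => ?_
  refine (norm_sphMoment_le k φ 0 fun ω _ => φ.norm_iteratedFDeriv_le_seminorm ℂ k _).trans ?_
  rw [mul_comm]
  gcongr
  exact le_add_of_nonneg_right (apply_nonneg _ _)

theorem continuous_kernelVec {N : ℕ} {β : ℂ} (h : β.re < N) :
    Continuous fun φ : 𝓢(Space m, ℂ) => kernelVec N β φ := by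
  unfold kernelVec
  refine Continuous.const_smul (((continuous_innerPart (n := 2 * N) (β := β)
    (by push_cast; linarith)).add
    (continuous_outerPart β)).const_smul (Complex.Gamma (1 / 2 - β))⁻¹ |>.add ?_)
    (kernelConst m β)
  exact continuous_finsetSum _ fun l _ => (continuous_sphMoment_zero _).const_smul
    (taylorCoeff l β / ((2 * l + 1).factorial : ℂ))

theorem isTempered_of_eq_ι_kernelVec {T : Functional m} {N : ℕ} {β : ℂ} (h : β.re < N)
    (hT : ∀ φ, T φ = CliffordAlgebra.ι (negForm m) (kernelVec N β φ)) : IsTempered T where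
  linear := ⟨fun φ ψ => by simp [hT, kernelVec_add h], fun c φ => by simp [hT, kernelVec_smul]⟩
  continuous ℓ := by
    simp_rw [hT]
    exact (ℓ ∘ₗ CliffordAlgebra.ι (negForm m)).continuous_of_finiteDimensional.comp
      (continuous_kernelVec h)

end Continuity

/-! ### The Fourier symbol -/

section Integrability

/-- In polar coordinates the singularity becomes `r^{s+m-1}`, integrable at zero for `s > -m`;
outside the unit ball an integer power `k ≥ s` dominates. -/
theorem integrable_norm_rpow_mul (hm : 1 ≤ m) {s : ℝ} (hs : -(m : ℝ) < s) (ψ : 𝓢(Space m, ℂ)) :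
    Integrable fun ξ : Space m => ‖ξ‖ ^ s * ‖ψ ξ‖ := by
  have := nontrivial_space hm
  obtain ⟨k, hk⟩ := exists_nat_ge s
  obtain ⟨C, hC⟩ := exists_bound_iteratedFDeriv 0 ψ
  simp only [norm_iteratedFDeriv_zero] at hC
  have hball : IntegrableOn (fun ξ : Space m => ‖ξ‖ ^ s) (Metric.ball 0 1) := by
    rw [integrableOn_fun_norm_addHaar volume (f := fun r => r ^ s)]
    have h1 : IntegrableOn (fun r : ℝ => r ^ (s + (m - 1))) (Ioo 0 1) :=
      (integrableOn_rpow_Ioc (by linarith)).mono_set Ioo_subset_Ioc_self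
    refine h1.congr_fun (fun r hr => ?_) measurableSet_Ioo
    simp only [finrank_euclideanSpace, Fintype.card_fin, smul_eq_mul]
    rw [← Real.rpow_natCast, ← Real.rpow_add hr.1, Nat.cast_sub hm]
    congr 1
    push_cast
    ring
  have hmeas : AEStronglyMeasurable (fun ξ : Space m => ‖ξ‖ ^ s * ‖ψ ξ‖) volume :=
    ((measurable_norm.pow_const s).aestronglyMeasurable).mul ψ.continuous.norm.aestronglyMeasurable
  refine ((hball.integrable_indicator Metric.isOpen_ball.measurableSet).const_mul C |>.add
    (ψ.integrable_pow_mul volume k)).mono' hmeas (Eventually.of_forall fun ξ => ?_)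
  rw [Real.norm_of_nonneg (by positivity)]
  simp only [Pi.add_apply]
  by_cases hξ : ‖ξ‖ < 1
  · rw [indicator_of_mem (by simpa using hξ)]
    have h1 : ‖ξ‖ ^ s * ‖ψ ξ‖ ≤ ‖ξ‖ ^ s * C := by gcongr; exact hC ξ
    have h2 : 0 ≤ ‖ξ‖ ^ k * ‖ψ ξ‖ := by positivity
    linarith
  · rw [indicator_of_notMem (by simpa using hξ), mul_zero, zero_add, ← Real.rpow_natCast]
    gcongr
    linarith

/-- The Fourier symbol of the kernel of `(-Δ)^β H`. -/
def rieszSymbol (β : ℂ) (ξ : Space m) : Fin m → ℂ :=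
  (-Complex.I * ((2 * Real.pi : ℝ) : ℂ) ^ (2 * β) * ((‖ξ‖ : ℝ) : ℂ) ^ (2 * β - 1)) • cvec ξ

theorem norm_rieszSymbol_le (β : ℂ) (ξ : Space m) :
    ‖rieszSymbol β ξ‖ ≤ (2 * Real.pi) ^ (2 * β.re) * ‖ξ‖ ^ (2 * β.re) := by
  -- At the origin the vector factor vanishes, so the value of the complex power there is
  -- immaterial.
  by_cases hξ : ξ = 0
  · have : cvec (0 : Space m) = 0 := by ext; simp [cvec]
    rw [rieszSymbol, hξ, this, smul_zero, norm_zero]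
    have := Real.pi_pos
    positivity
  · have hξ0 : 0 < ‖ξ‖ := norm_pos_iff.2 hξ
    rw [rieszSymbol, norm_smul, norm_mul, norm_mul, norm_neg, Complex.norm_I, one_mul,
      Complex.norm_cpow_eq_rpow_re_of_pos Real.two_pi_pos,
      Complex.norm_cpow_eq_rpow_re_of_pos hξ0]
    have h1 : (2 * β).re = 2 * β.re := by simp
    have h2 : (2 * β - 1).re = 2 * β.re - 1 := by simp
    rw [h1, h2, mul_assoc, Real.rpow_sub_one hξ0.ne']
    have := Real.two_pi_pos
    gcongr
    calc _ ≤ ‖ξ‖ ^ (2 * β.re) / ‖ξ‖ * ‖ξ‖ := by gcongr; exact norm_cvec_le ξ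
      _ = _ := by field_simp

theorem measurable_rieszSymbol (β : ℂ) : Measurable (rieszSymbol (m := m) β) := by
  unfold rieszSymbol
  have h1 : Measurable fun z : Space m => ((‖z‖ : ℝ) : ℂ) ^ (2 * β - 1) :=
    (measurable_cpow_ofReal _).comp measurable_norm
  exact (h1.const_mul _).smul continuous_cvec.measurable

theorem integrable_smul_rieszSymbol (hm : 1 ≤ m) {β : ℂ} (hβ : -(m : ℝ) / 2 < β.re)
    (ψ : 𝓢(Space m, ℂ)) : Integrable fun ξ : Space m => ψ ξ • rieszSymbol β ξ := by
  refine ((integrable_norm_rpow_mul hm (s := 2 * β.re) (by linarith) ψ).const_mul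
    ((2 * Real.pi) ^ (2 * β.re))).mono' ?_ (Eventually.of_forall fun ξ => ?_)
  · exact ψ.continuous.aestronglyMeasurable.smul (measurable_rieszSymbol β).aestronglyMeasurable
  · rw [norm_smul]
    calc _ ≤ ‖ψ ξ‖ * ((2 * Real.pi) ^ (2 * β.re) * ‖ξ‖ ^ (2 * β.re)) := by
          gcongr; exact norm_rieszSymbol_le β ξ
      _ = _ := by ring

theorem differentiableAt_integral_smul_rieszSymbol (hm : 1 ≤ m) {β₀ : ℂ}
    (hβ₀ : -(m : ℝ) / 2 < β₀.re) (ψ : 𝓢(Space m, ℂ)) :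
    DifferentiableAt ℂ (fun β => ∫ ξ : Space m, ψ ξ • rieszSymbol β ξ) β₀ := by
  -- The lower exponent `2(Re β₀ - ε)` is then `2ε - m > -m`, still locally integrable.
  set ε : ℝ := (β₀.re + m / 2) / 2 with hε
  have hε0 : 0 < ε := by rw [hε]; linarith
  have hint := fun {s : ℝ} (hs : -(m : ℝ) < s) =>
    (integrable_norm_rpow_mul hm hs ψ).const_mul ((2 * Real.pi) ^ (2 * (β₀.re + ε)))
  refine differentiableAt_integral_of_norm_le hε0
    (F := fun β ξ => ψ ξ • rieszSymbol β ξ)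
    (fun β _ => ψ.continuous.aestronglyMeasurable.smul
      (measurable_rieszSymbol β).aestronglyMeasurable)
    (Eventually.of_forall fun ξ β _ => ?_)
    (Eventually.of_forall fun ξ β hβ => ?_)
    ((hint (s := 2 * (β₀.re - ε)) (by linarith)).add (hint (s := 2 * (β₀.re + ε)) (by linarith)))
  · refine DifferentiableAt.const_smul (f := fun β => rieszSymbol β ξ) ?_ (ψ ξ)
    by_cases hξ : ξ = 0
    · have : cvec (0 : Space m) = 0 := by ext; simp [cvec]
      simp only [rieszSymbol, hξ, this, smul_zero]
      fun_prop
    · unfold rieszSymbol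
      refine DifferentiableAt.smul_const ?_ _
      have h1 : ((‖ξ‖ : ℝ) : ℂ) ≠ 0 := by exact_mod_cast (norm_pos_iff.2 hξ).ne'
      have h2 : ((2 * Real.pi : ℝ) : ℂ) ≠ 0 := by exact_mod_cast Real.two_pi_pos.ne'
      exact (DifferentiableAt.const_mul (DifferentiableAt.const_cpow (by fun_prop) (Or.inl h2))
        _).mul (DifferentiableAt.const_cpow (by fun_prop) (Or.inl h1))
  · have h1 : |β.re - β₀.re| < ε := by
      have := Complex.abs_re_le_norm (β - β₀)
      rw [Complex.sub_re] at this
      exact this.trans_lt (mem_ball_iff_norm.1 hβ)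
    obtain ⟨h2, h3⟩ := abs_lt.1 h1
    have hpi : 1 ≤ 2 * Real.pi := by linarith [Real.two_le_pi]
    -- For `‖ξ‖ ≤ 1` the smaller endpoint exponent dominates, for `‖ξ‖ ≥ 1` the larger one.
    have h4 : ‖ξ‖ ^ (2 * β.re) ≤ ‖ξ‖ ^ (2 * (β₀.re - ε)) + ‖ξ‖ ^ (2 * (β₀.re + ε)) ∨ ξ = 0 := by
      by_cases hξ : ξ = 0
      · exact Or.inr hξ
      have hξ0 : 0 < ‖ξ‖ := norm_pos_iff.2 hξ
      left
      rcases le_total ‖ξ‖ 1 with h | h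
      · have := Real.rpow_le_rpow_of_exponent_ge hξ0 h
          (show 2 * (β₀.re - ε) ≤ 2 * β.re by linarith)
        have : 0 ≤ ‖ξ‖ ^ (2 * (β₀.re + ε)) := by positivity
        linarith
      · have := Real.rpow_le_rpow_of_exponent_le h
          (show 2 * β.re ≤ 2 * (β₀.re + ε) by linarith)
        have : 0 ≤ ‖ξ‖ ^ (2 * (β₀.re - ε)) := by positivity
        linarith
    simp only [Pi.add_apply]
    rw [← mul_add, ← add_mul]
    rcases h4 with h4 | h4
    · have h5 : (2 * Real.pi) ^ (2 * β.re) ≤ (2 * Real.pi) ^ (2 * (β₀.re + ε)) :=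
        Real.rpow_le_rpow_of_exponent_le hpi (by linarith)
      rw [norm_smul]
      calc _ ≤ ‖ψ ξ‖ * ((2 * Real.pi) ^ (2 * β.re) * ‖ξ‖ ^ (2 * β.re)) := by
            gcongr; exact norm_rieszSymbol_le β ξ
        _ ≤ ‖ψ ξ‖ * ((2 * Real.pi) ^ (2 * (β₀.re + ε)) *
              (‖ξ‖ ^ (2 * (β₀.re - ε)) + ‖ξ‖ ^ (2 * (β₀.re + ε)))) := by gcongr
        _ = _ := by ring
    · have : cvec (0 : Space m) = 0 := by ext; simp [cvec]
      rw [rieszSymbol, h4, this, smul_zero, smul_zero, norm_zero]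
      positivity

end Integrability

/-! ### Gaussian superposition and the Fourier transform of the kernel -/

section Gaussian

theorem integral_fourier_mul_eq {f g : Space m → ℂ} (hf : Integrable f) (hg : Integrable g) :
    ∫ ξ, 𝓕 f ξ * g ξ = ∫ x, f x * 𝓕 g x :=
  VectorFourier.integral_fourierIntegral_smul_eq_flip (L := innerₗ (Space m))
    Real.continuous_fourierChar continuous_inner hf hg |>.trans (by
      simp only [flip_innerₗ, smul_eq_mul]; rfl)

/-- The Mellin transform of a superposition of Gaussians. -/
theorem mellin_integral_gaussian (hm : 1 ≤ m) {a : ℂ} (ha : 0 < a.re) {h : Space m → ℂ}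
    (hmeas : AEStronglyMeasurable h) (hint : Integrable fun z : Space m => ‖z‖ ^ (-2 * a.re) * ‖h z‖) :
    mellin (fun t => ∫ z : Space m, Complex.exp (-((t * ‖z‖ ^ 2 : ℝ) : ℂ)) * h z) a =
      Complex.Gamma a * ∫ z : Space m, ((‖z‖ : ℝ) : ℂ) ^ (-2 * a) * h z := by
  have := nontrivial_space hm
  have hne : ∀ᵐ z : Space m, z ≠ 0 := by
    simp [ae_iff]
  have hsq : ∀ z : Space m, z ≠ 0 → 0 < ‖z‖ ^ 2 := fun z hz => by
    have := norm_pos_iff.2 hz; positivity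
  let F : Space m → ℝ → ℂ := fun z t =>
    (t : ℂ) ^ (a - 1) * Complex.exp (-((t * ‖z‖ ^ 2 : ℝ) : ℂ)) * h z
  have hFmeas : AEStronglyMeasurable (Function.uncurry F)
      ((volume : Measure (Space m)).prod (volume.restrict (Ioi 0))) := by
    refine AEStronglyMeasurable.mul (AEStronglyMeasurable.mul ?_ ?_) hmeas.comp_fst
    · exact ((measurable_cpow_ofReal _).comp measurable_snd).aestronglyMeasurable
    · exact Continuous.aestronglyMeasurable (by fun_prop)
  have hFnorm : ∀ z : Space m, ∀ t ∈ Ioi (0 : ℝ),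
      ‖F z t‖ = t ^ (a.re - 1) * Real.exp (-(‖z‖ ^ 2 * t)) * ‖h z‖ := by
    intro z t ht
    simp only [F]
    rw [norm_mul, norm_mul, Complex.norm_cpow_eq_rpow_re_of_pos ht, Complex.norm_exp,
      ← Complex.ofReal_neg, Complex.ofReal_re, mul_comm t]
    simp
  -- Fubini: integrating in `t` first gives `Γ(Re a) ‖z‖^{-2 Re a} ‖h z‖`, integrable by `hint`.
  have hFint : Integrable (Function.uncurry F)
      ((volume : Measure (Space m)).prod (volume.restrict (Ioi 0))) := by
    rw [integrable_prod_iff hFmeas]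
    have h1 : ∀ z : Space m, z ≠ 0 → IntegrableOn (fun t : ℝ =>
        t ^ (a.re - 1) * Real.exp (-(‖z‖ ^ 2 * t))) (Ioi 0) := by
      intro z hz
      have := integrableOn_rpow_mul_exp_neg_mul_rpow (s := a.re - 1) (p := 1) (by linarith) one_pos
        (hsq z hz)
      simpa [neg_mul] using this
    constructor
    · filter_upwards [hne] with z hz
      have h2 : IntegrableOn (fun t : ℝ => ‖F z t‖) (Ioi 0) :=
        IntegrableOn.congr_fun (Integrable.mul_const (h1 z hz) ‖h z‖)
          (fun t ht => (hFnorm z t ht).symm) measurableSet_Ioi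
      refine (integrable_norm_iff ?_).1 h2
      refine AEStronglyMeasurable.mul (AEStronglyMeasurable.mul ?_ ?_)
        (aestronglyMeasurable_const (b := h z))
      · exact (measurable_cpow_ofReal _).aestronglyMeasurable
      · exact Continuous.aestronglyMeasurable (by fun_prop)
    · refine (hint.const_mul (Real.Gamma a.re)).congr ?_
      filter_upwards [hne] with z hz
      simp only [Function.uncurry_apply_pair]
      rw [setIntegral_congr_fun measurableSet_Ioi (hFnorm z), integral_mul_const,
        Real.integral_rpow_mul_exp_neg_mul_Ioi ha (hsq z hz), one_div, Real.inv_rpow (by positivity),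
        ← Real.rpow_natCast, ← Real.rpow_mul (norm_nonneg _), ← Real.rpow_neg (norm_nonneg _)]
      push_cast
      rw [neg_mul]
      ring
  have hswap := integral_integral_swap hFint
  have hL : mellin (fun t => ∫ z : Space m, Complex.exp (-((t * ‖z‖ ^ 2 : ℝ) : ℂ)) * h z) a =
      ∫ t in Ioi (0 : ℝ), ∫ z, F z t := by
    refine setIntegral_congr_fun measurableSet_Ioi fun t _ => ?_
    simp only [F, smul_eq_mul]
    rw [← integral_const_mul]
    simp_rw [mul_assoc]
  rw [hL, ← hswap, ← integral_const_mul]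
  refine integral_congr_ae ?_
  filter_upwards [hne] with z hz
  simp only [F]
  rw [integral_mul_const]
  have h2 : ∀ t : ℝ, (t : ℂ) ^ (a - 1) * Complex.exp (-((t * ‖z‖ ^ 2 : ℝ) : ℂ)) =
      (t : ℂ) ^ (a - 1) * Complex.exp (-(((‖z‖ ^ 2 : ℝ) : ℂ) * t)) := fun t => by
    push_cast; rw [mul_comm (t : ℂ)]
  simp_rw [h2]
  rw [Complex.integral_cpow_mul_exp_neg_mul_Ioi ha (hsq z hz)]
  have h3 : (1 / ((‖z‖ ^ 2 : ℝ) : ℂ)) ^ a = ((‖z‖ : ℝ) : ℂ) ^ (-2 * a) := by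
    have hz0 : 0 < ‖z‖ := norm_pos_iff.2 hz
    have h4 : (-2 : ℂ) * a = ((-2 : ℝ) : ℂ) * a := by push_cast; ring
    rw [h4, Complex.cpow_mul_ofReal_nonneg hz0.le, Real.rpow_neg hz0.le, one_div, ← Complex.ofReal_inv]
    norm_num
  rw [h3]
  ring

theorem integrable_gaussian_mul {t : ℝ} (ht : 0 ≤ t) {f : Space m → ℂ} (hf : Integrable f) :
    Integrable fun z : Space m => Complex.exp (-((t * ‖z‖ ^ 2 : ℝ) : ℂ)) * f z := by
  refine hf.bdd_mul (c := 1) (Continuous.aestronglyMeasurable (by fun_prop))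
    (Eventually.of_forall fun z => ?_)
  rw [Complex.norm_exp, ← Complex.ofReal_neg, Complex.ofReal_re]
  exact Real.exp_le_one_iff.2 (by nlinarith [sq_nonneg ‖z‖])

/-- Integration by parts against `∂_j exp(-t|z|²) = -2t z_j exp(-t|z|²)`. The coordinate becomes a
derivative, which the Fourier transform turns back into a coordinate. -/
theorem integral_gaussian_mul_coord {t : ℝ} (ht : 0 < t) (φ : 𝓢(Space m, ℂ)) (j : Fin m) :
    ∫ z : Space m, Complex.exp (-((t * ‖z‖ ^ 2 : ℝ) : ℂ)) * (cvec z j * φ z) =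
      (2 * t : ℂ)⁻¹ * ∫ z : Space m, Complex.exp (-((t * ‖z‖ ^ 2 : ℝ) : ℂ)) *
        (∂_{EuclideanSpace.single j (1 : ℝ)} φ) z := by
  set v : Space m := EuclideanSpace.single j (1 : ℝ)
  let g : Space m → ℂ := fun z => Complex.exp (-((t * ‖z‖ ^ 2 : ℝ) : ℂ))
  have hg : ∀ z : Space m, HasFDerivAt g (g z • (-(Complex.ofRealCLM.comp
      (t • (2 • innerSL ℝ z))))) z := by
    intro z
    have h1 : HasFDerivAt (fun z : Space m => t * ‖z‖ ^ 2) (t • (2 • innerSL ℝ z)) z :=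
      (HasStrictFDerivAt.hasFDerivAt (hasStrictFDerivAt_norm_sq z)).const_mul t
    exact ((Complex.ofRealCLM.hasFDerivAt.comp z h1).neg).cexp
  have hgv : ∀ z : Space m, fderiv ℝ g z v = -(2 * t : ℂ) * (g z * cvec z j) := by
    intro z
    rw [(hg z).fderiv]
    simp [v, cvec, EuclideanSpace.inner_single_right]
    ring
  have hcoord : Integrable fun z : Space m => cvec z j * φ z := by
    refine (φ.integrable_pow_mul volume 1).mono' ?_ (Eventually.of_forall fun z => ?_)
    · exact ((continuous_apply j).comp continuous_cvec).aestronglyMeasurable.mul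
        φ.continuous.aestronglyMeasurable
    · rw [norm_mul, pow_one]
      gcongr
      exact (norm_le_pi_norm (cvec z) j).trans (norm_cvec_le z)
  have hibp := integral_mul_fderiv_eq_neg_fderiv_mul_of_integrable (μ := (volume : Measure (Space m)))
    (f := φ) (g := g) (v := v) ?_ ?_ ?_ (fun z _ => φ.differentiable z)
    fun z _ => (hg z).differentiableAt
  · simp_rw [hgv] at hibp
    have h2 : ∀ z, fderiv ℝ φ z v = (∂_{v} φ) z := fun z =>
      (SchwartzMap.lineDerivOp_apply_eq_fderiv v φ z).symm
    simp_rw [h2] at hibp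
    have h3 : ∀ z, φ z * (-(2 * t : ℂ) * (g z * cvec z j)) =
        -(2 * t : ℂ) * (g z * (cvec z j * φ z)) := fun z => by ring
    simp_rw [h3] at hibp
    rw [integral_const_mul] at hibp
    have ht' : (2 * t : ℂ) ≠ 0 := by exact_mod_cast (by positivity : (2 * t : ℝ) ≠ 0)
    rw [eq_inv_mul_iff_mul_eq₀ ht']
    have h4 : ∫ z, (∂_{v} φ) z * g z = ∫ z, g z * (∂_{v} φ) z := by simp_rw [mul_comm]
    rw [h4] at hibp
    linear_combination -hibp
  · refine (integrable_gaussian_mul ht.le (∂_{v} φ).integrable).congr (Eventually.of_forall fun z => ?_)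
    simp only [g]
    rw [SchwartzMap.lineDerivOp_apply_eq_fderiv, mul_comm]
  · refine ((integrable_gaussian_mul ht.le hcoord).const_mul (-(2 * t : ℂ))).congr
      (Eventually.of_forall fun z => ?_)
    simp only [hgv, g]
    ring
  · refine (integrable_gaussian_mul ht.le φ.integrable).congr (Eventually.of_forall fun z => ?_)
    simp only [g]
    ring

theorem fourier_lineDeriv_single (φ : 𝓢(Space m, ℂ)) (j : Fin m) (ξ : Space m) :
    (𝓕 (∂_{EuclideanSpace.single j (1 : ℝ)} φ)) ξ =
      2 * Real.pi * Complex.I * (cvec ξ j * (𝓕 φ) ξ) := by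
  rw [SchwartzMap.fourier_lineDerivOp_eq]
  simp only [smul_apply]
  rw [SchwartzMap.smulLeftCLM_apply_apply (by fun_prop)]
  simp [cvec, EuclideanSpace.inner_single_right]

/-- `exp(-t|z|²)` is `(π/t)^{m/2}` times the Fourier transform of `exp(-π²|ξ|²/t)`, and the
transform can be moved onto `ψ`. -/
theorem integral_gaussian_mul_schwartz {t : ℝ} (ht : 0 < t) (ψ : 𝓢(Space m, ℂ)) :
    ∫ z : Space m, Complex.exp (-((t * ‖z‖ ^ 2 : ℝ) : ℂ)) * ψ z =
      ((Real.pi / t : ℝ) : ℂ) ^ ((m : ℂ) / 2) * ∫ ξ : Space m,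
        Complex.exp (-((Real.pi ^ 2 * t⁻¹ * ‖ξ‖ ^ 2 : ℝ) : ℂ)) * (𝓕 ψ) ξ := by
  have hint : Integrable fun ξ : Space m =>
      Complex.exp (-((Real.pi ^ 2 * t⁻¹ * ‖ξ‖ ^ 2 : ℝ) : ℂ)) := by
    have h := GaussianFourier.integrable_cexp_neg_mul_sq_norm_add (V := Space m)
      (b := ((Real.pi ^ 2 * t⁻¹ : ℝ) : ℂ))
      (by rw [Complex.ofReal_re]; have := Real.pi_pos; positivity) 0 0
    refine h.congr (Eventually.of_forall fun ξ => ?_)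
    simp
  have h1 : ∀ z : Space m, ((Real.pi / t : ℝ) : ℂ) ^ ((m : ℂ) / 2) *
      𝓕 (fun ξ : Space m => Complex.exp (-((Real.pi ^ 2 * t⁻¹ * ‖ξ‖ ^ 2 : ℝ) : ℂ))) z =
      Complex.exp (-((t * ‖z‖ ^ 2 : ℝ) : ℂ)) := by
    intro z
    have hb : 0 < ((Real.pi ^ 2 * t⁻¹ : ℝ) : ℂ).re := by
      rw [Complex.ofReal_re]; have := Real.pi_pos; positivity
    have h2 := fourier_gaussian_innerProductSpace (V := Space m) hb z
    have h3 : (fun ξ : Space m => Complex.exp (-((Real.pi ^ 2 * t⁻¹ * ‖ξ‖ ^ 2 : ℝ) : ℂ))) =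
        fun v => Complex.exp (-((Real.pi ^ 2 * t⁻¹ : ℝ) : ℂ) * ‖v‖ ^ 2) := by
      ext ξ; push_cast; ring_nf
    have hpi : (Real.pi : ℂ) ≠ 0 := by exact_mod_cast Real.pi_ne_zero
    have ht' : (t : ℂ) ≠ 0 := by exact_mod_cast ht.ne'
    have h4 : (Real.pi : ℂ) / ((Real.pi ^ 2 * t⁻¹ : ℝ) : ℂ) = ((t / Real.pi : ℝ) : ℂ) := by
      push_cast; field_simp
    rw [h3, h2, h4, finrank_euclideanSpace, Fintype.card_fin, ← mul_assoc,
      ← Complex.mul_cpow_ofReal_nonneg (by have := Real.pi_pos; positivity)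
        (by have := Real.pi_pos; positivity), ← Complex.ofReal_mul,
      div_mul_div_cancel₀ ht.ne', div_self Real.pi_ne_zero, Complex.ofReal_one, Complex.one_cpow,
      one_mul]
    congr 1
    push_cast
    field_simp
  have h5 : ∀ z : Space m, Complex.exp (-((t * ‖z‖ ^ 2 : ℝ) : ℂ)) * ψ z =
      ((Real.pi / t : ℝ) : ℂ) ^ ((m : ℂ) / 2) *
        (𝓕 (fun ξ : Space m => Complex.exp (-((Real.pi ^ 2 * t⁻¹ * ‖ξ‖ ^ 2 : ℝ) : ℂ))) z * ψ z) :=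
    fun z => by rw [← h1, mul_assoc]
  simp_rw [h5]
  rw [integral_const_mul, integral_fourier_mul_eq hint ψ.integrable]
  rfl

theorem integral_gaussian_mul_coord_eq {t : ℝ} (ht : 0 < t) (φ : 𝓢(Space m, ℂ)) (j : Fin m) :
    ∫ z : Space m, Complex.exp (-((t * ‖z‖ ^ 2 : ℝ) : ℂ)) * (cvec z j * φ z) =
      Complex.I * (Real.pi : ℂ) ^ ((m : ℂ) / 2 + 1) * ((t : ℂ) ^ (-(m : ℂ) / 2 - 1) *
        ∫ ξ : Space m, Complex.exp (-((Real.pi ^ 2 * t⁻¹ * ‖ξ‖ ^ 2 : ℝ) : ℂ)) *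
          (cvec ξ j * (𝓕 φ) ξ)) := by
  rw [integral_gaussian_mul_coord ht, integral_gaussian_mul_schwartz ht]
  simp_rw [fourier_lineDeriv_single]
  have h1 : ∀ ξ : Space m, Complex.exp (-((Real.pi ^ 2 * t⁻¹ * ‖ξ‖ ^ 2 : ℝ) : ℂ)) *
      (2 * Real.pi * Complex.I * (cvec ξ j * (𝓕 φ) ξ)) = (2 * Real.pi * Complex.I) *
      (Complex.exp (-((Real.pi ^ 2 * t⁻¹ * ‖ξ‖ ^ 2 : ℝ) : ℂ)) * (cvec ξ j * (𝓕 φ) ξ)) :=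
    fun ξ => by ring
  simp_rw [h1]
  rw [integral_const_mul]
  have hpi : (Real.pi : ℂ) ≠ 0 := by exact_mod_cast Real.pi_ne_zero
  have ht' : (t : ℂ) ≠ 0 := by exact_mod_cast ht.ne'
  have h2 : ((Real.pi / t : ℝ) : ℂ) ^ ((m : ℂ) / 2) =
      (Real.pi : ℂ) ^ ((m : ℂ) / 2) * (t : ℂ) ^ (-(m : ℂ) / 2) := by
    rw [div_eq_mul_inv, Complex.ofReal_mul, Complex.mul_cpow_ofReal_nonneg Real.pi_pos.le
      (by positivity), Complex.ofReal_inv, Complex.inv_cpow, ← Complex.cpow_neg, neg_div]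
    rw [Complex.arg_ofReal_of_nonneg ht.le]
    exact Real.pi_pos.ne
  rw [h2, Complex.cpow_add _ _ hpi, Complex.cpow_sub _ _ ht', Complex.cpow_one, Complex.cpow_one]
  field_simp

/-- The coordinate factor gains one power at the origin, whence the bound `-m - 1` in place of `-m`.
-/
theorem integrable_norm_rpow_mul_coord (hm : 1 ≤ m) {s : ℝ} (hs : -(m : ℝ) - 1 < s)
    (ψ : 𝓢(Space m, ℂ)) (j : Fin m) :
    Integrable fun z : Space m => ‖z‖ ^ s * ‖cvec z j * ψ z‖ := by
  have hne : ∀ᵐ z : Space m, z ≠ 0 := by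
    have := nontrivial_space hm
    simp [ae_iff]
  refine (integrable_norm_rpow_mul hm (s := s + 1) (by linarith) ψ).mono' ?_ ?_
  · exact ((measurable_norm.pow_const s).aestronglyMeasurable).mul
      (((continuous_apply j).comp continuous_cvec).mul ψ.continuous).norm.aestronglyMeasurable
  · filter_upwards [hne] with z hz
    have hz0 : 0 < ‖z‖ := norm_pos_iff.2 hz
    rw [Real.norm_of_nonneg (by positivity), norm_mul, Real.rpow_add_one hz0.ne', mul_assoc]
    gcongr
    exact (norm_le_pi_norm (cvec z) j).trans (norm_cvec_le z)

/-- The Fourier transform of the homogeneous kernel `z_j |z|^{-m-1-2β}`. -/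
theorem integral_cpow_mul_coord (hm : 1 ≤ m) {β : ℂ} (h1 : -1 / 2 < β.re) (h2 : β.re < 0)
    (φ : 𝓢(Space m, ℂ)) (j : Fin m) :
    Complex.Gamma ((m + 2 * β + 1) / 2) *
      ∫ z : Space m, ((‖z‖ : ℝ) : ℂ) ^ (-2 * β - m - 1) * (cvec z j * φ z) =
    Complex.I * (Real.pi : ℂ) ^ ((m : ℂ) / 2 + 2 * β) * Complex.Gamma (1 / 2 - β) *
      ∫ ξ : Space m, ((‖ξ‖ : ℝ) : ℂ) ^ (2 * β - 1) * (cvec ξ j * (𝓕 φ) ξ) := by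
  have hm' : (1 : ℝ) ≤ m := by exact_mod_cast hm
  -- Chosen so that `‖z‖^{-2a}` is the kernel's power. Integrability of the left side amounts to `Re
  -- β < 0`; on the Fourier side, with exponent `1/2 - β`, it needs `Re β > -m/2`.
  set a : ℂ := (m + 2 * β + 1) / 2 with ha
  have hare : a.re = (m + 2 * β.re + 1) / 2 := by
    have : a = (((m + 2 * β.re + 1) / 2 : ℝ) : ℂ) + ((β.im : ℝ) : ℂ) * Complex.I := by
      rw [ha]
      nth_rw 1 [← Complex.re_add_im β]
      push_cast
      ring
    rw [this]
    simp
  have hmeas : ∀ ψ : 𝓢(Space m, ℂ), AEStronglyMeasurable (fun z : Space m => cvec z j * ψ z) :=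
    fun ψ => (((continuous_apply j).comp continuous_cvec).mul ψ.continuous).aestronglyMeasurable
  have hL := mellin_integral_gaussian hm (a := a) (by rw [hare]; linarith) (hmeas φ)
    (integrable_norm_rpow_mul_coord hm (by rw [hare]; linarith) φ j)
  have hb : (1 / 2 - β).re = 1 / 2 - β.re := by simp
  have hR := mellin_integral_gaussian hm (a := 1 / 2 - β) (by rw [hb]; linarith) (hmeas (𝓕 φ))
    (integrable_norm_rpow_mul_coord hm (by rw [hb]; linarith) (𝓕 φ) j)
  set H : ℝ → ℂ := fun t => ∫ z : Space m, Complex.exp (-((t * ‖z‖ ^ 2 : ℝ) : ℂ)) *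
    (cvec z j * (𝓕 φ) z) with hH
  have hG : mellin (fun t => ∫ z : Space m, Complex.exp (-((t * ‖z‖ ^ 2 : ℝ) : ℂ)) *
      (cvec z j * φ z)) a = mellin (fun t : ℝ => (Complex.I * (Real.pi : ℂ) ^ ((m : ℂ) / 2 + 1)) •
        ((t : ℂ) ^ (-(m : ℂ) / 2 - 1) • H (Real.pi ^ 2 * t⁻¹))) a := by
    refine setIntegral_congr_fun measurableSet_Ioi fun t ht => ?_
    simp only [smul_eq_mul, hH]
    rw [integral_gaussian_mul_coord_eq ht]
  have hpi : (Real.pi : ℂ) ≠ 0 := by exact_mod_cast Real.pi_ne_zero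
  -- The inversion `t ↦ π²/t` reflects the Mellin variable: the factor `t^{-m/2-1}` shifts `a` to `β
  -- - 1/2`, and the reflection gives `1/2 - β`.
  rw [hG, mellin_const_smul, mellin_cpow_smul, mellin_comp_inv (fun t => H (Real.pi ^ 2 * t)),
    mellin_comp_mul_left H _ (by have := Real.pi_pos; positivity),
    show -(a + (-(m : ℂ) / 2 - 1)) = 1 / 2 - β by rw [ha]; ring, hR] at hL
  rw [show -2 * β - m - 1 = -2 * a by rw [ha]; ring, ← hL,
    show 2 * β - 1 = -2 * (1 / 2 - β) by ring]
  have h3 : ((Real.pi ^ 2 : ℝ) : ℂ) ^ (-(1 / 2 - β)) = (Real.pi : ℂ) ^ (2 * β - 1) := by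
    rw [show 2 * β - 1 = ((2 : ℝ) : ℂ) * (-(1 / 2 - β)) by push_cast; ring,
      Complex.cpow_mul_ofReal_nonneg Real.pi_pos.le]
    norm_num
  have h4 : (Real.pi : ℂ) ^ ((m : ℂ) / 2 + 2 * β) =
      (Real.pi : ℂ) ^ ((m : ℂ) / 2 + 1) * (Real.pi : ℂ) ^ (2 * β - 1) := by
    rw [← Complex.cpow_add _ _ hpi]
    congr 1
    ring
  rw [h3, h4]
  simp only [smul_eq_mul]
  ring

end Gaussian

/-! ### The kernel as the Fourier transform of its symbol -/

theorem integrable_cpow_smul_cvec (hm : 1 ≤ m) {β : ℂ} (h : β.re < 0) (φ : 𝓢(Space m, ℂ)) :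
    Integrable fun z : Space m => (((‖z‖ : ℝ) : ℂ) ^ (-2 * β - m - 1) * φ z) • cvec z := by
  have hne : ∀ᵐ z : Space m, z ≠ 0 := by
    have := nontrivial_space hm
    simp [ae_iff]
  refine (integrable_norm_rpow_mul hm (s := -2 * β.re - m) (by linarith) φ).mono' ?_ ?_
  · have h1 : Measurable fun z : Space m => ((‖z‖ : ℝ) : ℂ) ^ (-2 * β - m - 1) :=
      (measurable_cpow_ofReal _).comp measurable_norm
    exact ((h1.aestronglyMeasurable.mul φ.continuous.aestronglyMeasurable).smul
      continuous_cvec.aestronglyMeasurable)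
  · filter_upwards [hne] with z hz
    have hz0 : 0 < ‖z‖ := norm_pos_iff.2 hz
    have h1 : (-2 * β - m - 1).re = -2 * β.re - m - 1 := by simp
    rw [norm_smul, norm_mul, Complex.norm_cpow_eq_rpow_re_of_pos hz0, h1,
      Real.rpow_sub_one hz0.ne']
    calc _ ≤ ‖z‖ ^ (-2 * β.re - m) / ‖z‖ * ‖φ z‖ * ‖z‖ := by
          gcongr; exact norm_cvec_le z
      _ = _ := by field_simp

theorem two_mul_add_one_sub_ne_zero {β : ℂ} (h : β.re < 1 / 2) (l : ℕ) :
    (2 * l + 1 : ℂ) - 2 * β ≠ 0 := fun h0 => by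
  have := congrArg Complex.re h0
  simp at this
  linarith [Nat.cast_nonneg (α := ℝ) l]

/-- For `Re β < 0` no finite part is needed. -/
theorem kernelVec_eq_integral (hm : 1 ≤ m) (N : ℕ) {β : ℂ} (h : β.re < 0) (φ : 𝓢(Space m, ℂ)) :
    kernelVec N β φ = (kernelConst m β * (Complex.Gamma (1 / 2 - β))⁻¹) •
      ∫ z : Space m, (((‖z‖ : ℝ) : ℂ) ^ (-2 * β - m - 1) * φ z) • cvec z := by
  have hint := integrable_cpow_smul_cvec hm h φ
  rw [kernelVec_eq_smul_sum N (two_mul_add_one_sub_ne_zero (by linarith)) φ]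
  congr 1
  -- With `n = 0` nothing is subtracted, so all Taylor terms recombine into the plain integral over
  -- the unit ball.
  have h1 := innerPart_eq_add_sum (n := 0) (β := β) (by push_cast; linarith) φ (2 * N)
  rw [zero_add, Nat.Ico_zero_eq_range] at h1
  rw [add_right_comm, ← h1, ← integral_add_compl measurableSet_one_lt_norm hint, add_comm]
  congr 1
  have h2 := setIntegral_cpow_smul_cvec hm β φ (s := Iic 1) measurableSet_Iic hint.integrableOn
  have h3 : {z : Space m | 1 < ‖z‖}ᶜ = {z | ‖z‖ ∈ Iic 1} := by ext; simp
  rw [h3, h2]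
  simp [innerPart, sphRemainder, Ioi_inter_Iic]

/-- On this strip both sides converge absolutely. The factor `Γ((m+2β+1)/2)` in `kernelConst` is the
one in the Mellin identity, and `Γ(1/2 - β)` cancels. -/
theorem kernelVec_eq_fourier_aux (hm : 1 ≤ m) (N : ℕ) {β : ℂ} (h1 : -1 / 2 < β.re) (h2 : β.re < 0)
    (φ : 𝓢(Space m, ℂ)) :
    kernelVec N β φ = ∫ ξ : Space m, (𝓕 φ) ξ • rieszSymbol β ξ := by
  have hm' : (1 : ℝ) ≤ m := by exact_mod_cast hm
  have hint1 := integrable_cpow_smul_cvec hm h2 φ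
  have hint2 := integrable_smul_rieszSymbol hm (β := β) (by linarith) (𝓕 φ)
  rw [kernelVec_eq_integral hm N h2]
  ext j
  rw [Pi.smul_apply, eval_integral fun i => hint1.eval i, eval_integral fun i => hint2.eval i]
  have h3 := integral_cpow_mul_coord hm h1 h2 φ j
  have e1 : ∀ z : Space m, ((((‖z‖ : ℝ) : ℂ) ^ (-2 * β - m - 1) * φ z) • cvec z) j =
      ((‖z‖ : ℝ) : ℂ) ^ (-2 * β - m - 1) * (cvec z j * φ z) := fun z => by
    rw [Pi.smul_apply, smul_eq_mul]; ring
  have e2 : ∀ ξ : Space m, ((𝓕 φ) ξ • rieszSymbol β ξ) j =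
      (-Complex.I * ((2 * Real.pi : ℝ) : ℂ) ^ (2 * β)) *
        (((‖ξ‖ : ℝ) : ℂ) ^ (2 * β - 1) * (cvec ξ j * (𝓕 φ) ξ)) := fun ξ => by
    rw [rieszSymbol, Pi.smul_apply, Pi.smul_apply, smul_eq_mul, smul_eq_mul]; ring
  simp_rw [e1, e2]
  rw [integral_const_mul, smul_eq_mul, kernelConst]
  have hG : Complex.Gamma (1 / 2 - β) ≠ 0 :=
    Complex.Gamma_ne_zero_of_re_pos (by simp; linarith)
  have hpi : (Real.pi : ℂ) ≠ 0 := by exact_mod_cast Real.pi_ne_zero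
  have h4 : ((2 * Real.pi : ℝ) : ℂ) ^ (2 * β) =
      (2 : ℂ) ^ (2 * β) * ((Real.pi : ℂ) ^ (-(m : ℂ) / 2) * (Real.pi : ℂ) ^ ((m : ℂ) / 2 + 2 * β)) := by
    rw [← Complex.cpow_add _ _ hpi, Complex.ofReal_mul,
      Complex.mul_cpow_ofReal_nonneg zero_le_two Real.pi_pos.le, Complex.ofReal_ofNat]
    congr 2
    ring
  rw [h4]
  generalize ∫ z : Space m, ((‖z‖ : ℝ) : ℂ) ^ (-2 * β - m - 1) * (cvec z j * φ z) = I₁ at h3 ⊢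
  generalize ∫ ξ : Space m, ((‖ξ‖ : ℝ) : ℂ) ^ (2 * β - 1) * (cvec ξ j * (𝓕 φ) ξ) = I₂ at h3 ⊢
  calc _ = -((2 : ℂ) ^ (2 * β) * (Real.pi : ℂ) ^ (-(m : ℂ) / 2)) * (Complex.Gamma (1 / 2 - β))⁻¹ *
        (Complex.Gamma ((m + 2 * β + 1) / 2) * I₁) := by ring
    _ = _ := by
      rw [h3]
      generalize Complex.Gamma (1 / 2 - β) = G at hG ⊢
      field_simp

theorem ne_neg_of_re_gt {β : ℂ} (h : -(m : ℝ) / 2 < β.re) (n : ℕ) :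
    β ≠ -(((m : ℂ) + 1) / 2 + n) := by
  rintro rfl
  have : (-(((m : ℂ) + 1) / 2 + n)).re = -(((m : ℝ) + 1) / 2 + n) := by
    have : (-(((m : ℂ) + 1) / 2 + n)) = ((-(((m : ℝ) + 1) / 2 + n) : ℝ) : ℂ) := by push_cast; ring
    rw [this, Complex.ofReal_re]
  rw [this] at h
  linarith [Nat.cast_nonneg (α := ℝ) n]

/-- The kernel of `(-Δ)^β H` is the Fourier transform of its symbol. -/
theorem kernelVec_eq_fourier (hm : 1 ≤ m) {N : ℕ} {β : ℂ} (h1 : -(m : ℝ) / 2 < β.re)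
    (h2 : β.re < N) (φ : 𝓢(Space m, ℂ)) :
    kernelVec N β φ = ∫ ξ : Space m, (𝓕 φ) ξ • rieszSymbol β ξ := by
  have hm' : (1 : ℝ) ≤ m := by exact_mod_cast hm
  -- Both sides are holomorphic on this convex strip: the left bound keeps the symbol locally
  -- integrable, the right one keeps `kernelVec N` convergent. They agree near `-1/4`.
  set W : Set ℂ := {z | -(m : ℝ) / 2 < z.re} ∩ {z | z.re < N}
  have hWo : IsOpen W := (isOpen_lt continuous_const Complex.continuous_re).inter
    (isOpen_lt Complex.continuous_re continuous_const)
  have hWc : IsPreconnected W :=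
    ((convex_halfSpace_re_gt _).inter (convex_halfSpace_re_lt _)).isPreconnected
  have hf : AnalyticOnNhd ℂ (fun β => kernelVec N β φ) W := DifferentiableOn.analyticOnNhd
    (fun z hz => (differentiableAt_kernelVec hz.2 (ne_neg_of_re_gt hz.1) φ).differentiableWithinAt) hWo
  have hg : AnalyticOnNhd ℂ (fun β => ∫ ξ : Space m, (𝓕 φ) ξ • rieszSymbol β ξ) W :=
    DifferentiableOn.analyticOnNhd (fun z hz =>
      (differentiableAt_integral_smul_rieszSymbol hm hz.1 (𝓕 φ)).differentiableWithinAt) hWo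
  have hre : (((-1 / 4 : ℝ) : ℂ)).re = -1 / 4 := Complex.ofReal_re _
  have hz₀ : ((-1 / 4 : ℝ) : ℂ) ∈ W := by
    constructor
    · change _ < (((-1 / 4 : ℝ) : ℂ)).re
      rw [hre]; linarith
    · change (((-1 / 4 : ℝ) : ℂ)).re < _
      rw [hre]; linarith [Nat.cast_nonneg (α := ℝ) N]
  refine hf.eqOn_of_preconnected_of_eventuallyEq hg hWc hz₀ ?_ ⟨h1, h2⟩
  have ho : IsOpen ({z : ℂ | -1 / 2 < z.re} ∩ {z | z.re < 0}) :=
    (isOpen_lt continuous_const Complex.continuous_re).inter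
    (isOpen_lt Complex.continuous_re continuous_const)
  have hmem : ((-1 / 4 : ℝ) : ℂ) ∈ ({z : ℂ | -1 / 2 < z.re} ∩ {z | z.re < 0}) := by
    constructor
    · change _ < (((-1 / 4 : ℝ) : ℂ)).re
      rw [hre]; norm_num
    · change (((-1 / 4 : ℝ) : ℂ)).re < _
      rw [hre]; norm_num
  filter_upwards [ho.mem_nhds hmem] with z hz
  exact kernelVec_eq_fourier_aux hm N hz.1 hz.2 φ

/-! ### Powers of the Dirac operator applied to the delta distribution -/

section Dirac

theorem ι_eq_sum (v : Fin m → ℂ) : CliffordAlgebra.ι (negForm m) v = ∑ j, v j • e m j := by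
  conv_lhs => rw [← Finset.univ_sum_single v]
  rw [map_sum]
  refine Finset.sum_congr rfl fun j _ => ?_
  rw [e, ← map_smul]
  congr 1
  ext i
  by_cases h : i = j
  · subst h; simp
  · simp [h]

theorem ι_mul_self (v : Fin m → ℂ) :
    CliffordAlgebra.ι (negForm m) v * CliffordAlgebra.ι (negForm m) v =
      algebraMap ℂ (Cl m) (-∑ j, v j * v j) := by
  rw [CliffordAlgebra.ι_sq_scalar, QuadraticMap.weightedSumSquares_apply]
  simp

theorem e_mul_e_add_swap (j k : Fin m) :
    e m j * e m k + e m k * e m j = algebraMap ℂ (Cl m) (if j = k then -2 else 0) := by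
  unfold e
  rw [CliffordAlgebra.ι_mul_ι_add_swap, QuadraticMap.polar]
  simp only [QuadraticMap.weightedSumSquares_apply, Pi.add_apply, smul_eq_mul, neg_mul, one_mul,
    Finset.sum_neg_distrib]
  congr 1
  simp only [mul_add, add_mul, Finset.sum_add_distrib]
  by_cases h : j = k
  · subst h; simp [Pi.single_apply]; norm_num
  · have h' : k ≠ j := fun h0 => h h0.symm
    simp [Pi.single_apply, h, h']

/-- Averaging with the sum in which `j` and `k` are exchanged leaves only anticommutators. This is
the algebra behind `∂² = -Δ`. -/
theorem sum_e_mul_e_mul_of_symm {x : Fin m → Fin m → ℂ} (hx : ∀ j k, x j k = x k j) :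
    ∑ j, ∑ k, x j k • (e m j * e m k) = algebraMap ℂ (Cl m) (-∑ j, x j j) := by
  have h1 : ∑ j, ∑ k, x j k • (e m j * e m k) = ∑ j, ∑ k, x j k • (e m k * e m j) := by
    rw [Finset.sum_comm]
    simp_rw [hx]
  have h2 : (2 : ℂ) • ∑ j, ∑ k, x j k • (e m j * e m k) =
      (2 : ℂ) • algebraMap ℂ (Cl m) (-∑ j, x j j) := by
    rw [two_smul]
    nth_rw 2 [h1]
    simp_rw [← Finset.sum_add_distrib, ← smul_add, e_mul_e_add_swap, Algebra.algebraMap_eq_smul_one,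
      smul_smul, ← Finset.sum_smul]
    congr 1
    simp [Finset.mul_sum, mul_comm]
  exact smul_right_injective _ (two_ne_zero (α := ℂ)) h2

theorem laplacian_eq_sum_single (φ : 𝓢(Space m, ℂ)) :
    Δ φ = ∑ j : Fin m, ∂_{EuclideanSpace.single j (1 : ℝ)} (∂_{EuclideanSpace.single j (1 : ℝ)} φ) := by
  rw [SchwartzMap.laplacian_eq_sum (EuclideanSpace.basisFun (Fin m) ℝ)]
  simp

/-- The value at the origin of an iterated Laplacian. -/
def laplacianAtZero (l : ℕ) (φ : 𝓢(Space m, ℂ)) : ℂ := ((fun ψ : 𝓢(Space m, ℂ) => -Δ ψ)^[l] φ) 0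

theorem fourier_neg_laplacian (φ : 𝓢(Space m, ℂ)) (ξ : Space m) :
    (𝓕 (-Δ φ)) ξ = ((2 * Real.pi * ‖ξ‖ : ℝ) : ℂ) ^ 2 * (𝓕 φ) ξ := by
  have h1 : ((‖ξ‖ : ℝ) : ℂ) ^ 2 = ∑ j, cvec ξ j * cvec ξ j := by
    rw [← Complex.ofReal_pow, EuclideanSpace.real_norm_sq_eq, Complex.ofReal_sum]
    exact Finset.sum_congr rfl fun j _ => by rw [Complex.ofReal_pow, sq]; rfl
  rw [FourierTransform.fourier_neg, laplacian_eq_sum_single, FourierTransform.fourier_sum,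
    neg_apply, sum_apply]
  simp_rw [fourier_lineDeriv_single]
  push_cast
  rw [mul_pow, h1, Finset.mul_sum, Finset.sum_mul, ← Finset.sum_neg_distrib]
  refine Finset.sum_congr rfl fun j _ => ?_
  linear_combination (-4 * Real.pi ^ 2 * (cvec ξ j) ^ 2 * (𝓕 φ) ξ) * Complex.I_sq

theorem apply_zero_eq_integral_fourier (φ : 𝓢(Space m, ℂ)) : φ 0 = ∫ ξ : Space m, (𝓕 φ) ξ := by
  have h := congrArg (fun ψ : 𝓢(Space m, ℂ) => ψ 0) (FourierTransform.fourierInv_fourier_eq (F := 𝓢(Space m, ℂ)) φ)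
  rw [← h]
  simp only [SchwartzMap.fourierInv_coe, Real.fourierInv_eq]
  simp

/-- Fourier inversion at the origin, with `-Δ` acting as multiplication by `(2π|ξ|)²`. -/
theorem laplacianAtZero_eq (l : ℕ) (φ : 𝓢(Space m, ℂ)) :
    laplacianAtZero l φ = ∫ ξ : Space m, ((2 * Real.pi * ‖ξ‖ : ℝ) : ℂ) ^ (2 * l) * (𝓕 φ) ξ := by
  induction l generalizing φ with
  | zero => simpa [laplacianAtZero] using apply_zero_eq_integral_fourier φ
  | succ l ih =>
    rw [laplacianAtZero, Function.iterate_succ_apply]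
    refine (ih (-Δ φ)).trans (integral_congr_ae (Eventually.of_forall fun ξ => ?_))
    simp only [fourier_neg_laplacian]
    ring

theorem laplacianAtZero_add (l : ℕ) (φ ψ : 𝓢(Space m, ℂ)) :
    laplacianAtZero l (φ + ψ) = laplacianAtZero l φ + laplacianAtZero l ψ := by
  induction l generalizing φ ψ with
  | zero => rfl
  | succ l ih =>
    simp only [laplacianAtZero, Function.iterate_succ_apply] at ih ⊢
    rw [← ih, laplacian_eq_sum_single, laplacian_eq_sum_single, laplacian_eq_sum_single]
    congr 2
    simp only [LineDeriv.lineDerivOp_add, Finset.sum_add_distrib, neg_add]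

/-- On the Fourier side both derivatives are multiplications by coordinates, which commute. -/
theorem laplacianAtZero_lineDeriv_comm (l : ℕ) (φ : 𝓢(Space m, ℂ)) (j k : Fin m) :
    laplacianAtZero l (∂_{EuclideanSpace.single j (1 : ℝ)} (∂_{EuclideanSpace.single k (1 : ℝ)} φ)) =
      laplacianAtZero l
        (∂_{EuclideanSpace.single k (1 : ℝ)} (∂_{EuclideanSpace.single j (1 : ℝ)} φ)) := by
  rw [laplacianAtZero_eq, laplacianAtZero_eq]
  refine integral_congr_ae (Eventually.of_forall fun ξ => ?_)
  simp only [fourier_lineDeriv_single]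
  ring

theorem dirac_iterate_even (l : ℕ) (φ : 𝓢(Space m, ℂ)) :
    (dirac^[2 * l] (delta m)) φ = algebraMap ℂ (Cl m) (laplacianAtZero l φ) := by
  induction l generalizing φ with
  | zero => rfl
  | succ l ih =>
    rw [show 2 * (l + 1) = 2 * l + 1 + 1 by ring, Function.iterate_succ_apply',
      Function.iterate_succ_apply']
    simp only [dirac, ih, Finset.mul_sum, Algebra.algebraMap_eq_smul_one, mul_neg, neg_neg,
      Finset.sum_neg_distrib, mul_smul_comm, mul_one]
    have h := sum_e_mul_e_mul_of_symm (m := m) fun j k => laplacianAtZero_lineDeriv_comm l φ k j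
    rw [h, ← Algebra.algebraMap_eq_smul_one]
    congr 1
    have h2 := map_sum (AddMonoidHom.mk' (laplacianAtZero l) (laplacianAtZero_add (m := m) l))
      (fun j : Fin m => ∂_{EuclideanSpace.single j (1 : ℝ)} (∂_{EuclideanSpace.single j (1 : ℝ)} φ))
      Finset.univ
    have h3 := map_neg (AddMonoidHom.mk' (laplacianAtZero l) (laplacianAtZero_add (m := m) l)) (Δ φ)
    simp only [AddMonoidHom.mk'_apply] at h2 h3
    rw [show ∑ j, laplacianAtZero l (∂_{EuclideanSpace.single j (1 : ℝ)}
        (∂_{EuclideanSpace.single j (1 : ℝ)} φ)) = laplacianAtZero l (Δ φ) by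
      rw [laplacian_eq_sum_single, h2], ← h3]
    rfl

theorem dirac_iterate_odd (l : ℕ) (φ : 𝓢(Space m, ℂ)) :
    (dirac^[2 * l + 1] (delta m)) φ = CliffordAlgebra.ι (negForm m)
      (fun j => -laplacianAtZero l (∂_{EuclideanSpace.single j (1 : ℝ)} φ)) := by
  rw [Function.iterate_succ_apply', dirac, ι_eq_sum]
  refine Finset.sum_congr rfl fun j _ => ?_
  rw [dirac_iterate_even, Algebra.algebraMap_eq_smul_one, ← neg_smul, mul_smul_comm, mul_one]

end Dirac

/-! ### The exceptional parameters `β = l + 1/2` -/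

theorem UStar_of_eq {lam : ℂ} (l : ℕ) (h : lam = -m - 2 * l - 1) (φ : 𝓢(Space m, ℂ)) :
    UStar m lam φ = (-((Real.pi : ℂ) ^ ((m : ℂ) / 2 - l) /
      ((2 : ℂ) ^ (2 * l + 1) * Complex.Gamma ((m : ℂ) / 2 + l + 1)))) •
        (dirac^[2 * l + 1] (delta m)) φ := by
  have hex : ∃ l : ℕ, lam = -m - 2 * l - 1 := ⟨l, h⟩
  have hl : hex.choose = l := by
    have h2 : (l : ℂ) = hex.choose := by linear_combination (h - hex.choose_spec) / 2
    exact_mod_cast h2.symm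
  rw [UStar, dif_pos hex, hl]

theorem laplaceH_half (l : ℕ) (φ : 𝓢(Space m, ℂ)) :
    laplaceH m (l + 1 / 2) φ = (dirac^[2 * l + 1] (delta m)) φ := by
  have hpi : (Real.pi : ℂ) ≠ 0 := by exact_mod_cast Real.pi_ne_zero
  rw [laplaceH, UStar_of_eq l (by ring), smul_smul]
  convert one_smul ℂ _
  have h1 : (2 : ℂ) ^ (2 * ((l : ℂ) + 1 / 2)) = 2 ^ (2 * l + 1) := by
    rw [← Complex.cpow_natCast]
    congr 1
    push_cast
    ring
  have h2 : ((m : ℂ) + 2 * (l + 1 / 2) + 1) / 2 = m / 2 + l + 1 := by ring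
  have h3 : ((m : ℂ) - 2 * (l + 1 / 2) + 1) / 2 = m / 2 - l := by ring
  rw [h1, h2, h3]
  have h4 : Complex.Gamma ((m : ℂ) / 2 + l + 1) ≠ 0 := by
    refine Complex.Gamma_ne_zero_of_re_pos ?_
    have : ((m : ℂ) / 2 + l + 1) = (((m : ℝ) / 2 + l + 1 : ℝ) : ℂ) := by push_cast; ring
    rw [this, Complex.ofReal_re]
    positivity
  have h5 : (Real.pi : ℂ) ^ ((m : ℂ) / 2 - l) ≠ 0 := by simp [Complex.cpow_eq_zero_iff, hpi]
  generalize Complex.Gamma ((m : ℂ) / 2 + l + 1) = G at h4 ⊢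
  generalize (Real.pi : ℂ) ^ ((m : ℂ) / 2 - l) = P at h5 ⊢
  field_simp

/-- Here the symbol is the polynomial `-i (2π)^{2l+1} |ξ|^{2l} ξ`, so its Fourier integral is a
derivative at the origin. -/
theorem kernelVec_half (hm : 1 ≤ m) {N l : ℕ} (hN : l + 1 ≤ N) (φ : 𝓢(Space m, ℂ)) (j : Fin m) :
    kernelVec N (l + 1 / 2) φ j =
      -laplacianAtZero l (∂_{EuclideanSpace.single j (1 : ℝ)} φ) := by
  have hre : ((l : ℂ) + 1 / 2).re = l + 1 / 2 := by simp
  have hlt : -(m : ℝ) / 2 < ((l : ℂ) + 1 / 2).re := by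
    rw [hre]
    have := Nat.cast_nonneg (α := ℝ) l
    have := Nat.cast_nonneg (α := ℝ) m
    linarith
  have hN' : (l : ℝ) + 1 ≤ N := by exact_mod_cast hN
  rw [kernelVec_eq_fourier hm hlt (by rw [hre]; linarith), laplacianAtZero_eq,
    eval_integral fun i => (integrable_smul_rieszSymbol hm hlt (𝓕 φ)).eval i, ← integral_neg]
  refine integral_congr_ae (Eventually.of_forall fun ξ => ?_)
  have h1 : ((2 * Real.pi : ℝ) : ℂ) ^ (2 * ((l : ℂ) + 1 / 2)) =
      ((2 * Real.pi : ℝ) : ℂ) ^ (2 * l + 1) := by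
    rw [← Complex.cpow_natCast]
    congr 1
    push_cast
    ring
  have h2 : ((‖ξ‖ : ℝ) : ℂ) ^ (2 * ((l : ℂ) + 1 / 2) - 1) = ((‖ξ‖ : ℝ) : ℂ) ^ (2 * l) := by
    rw [← Complex.cpow_natCast]
    congr 1
    push_cast
    ring
  simp only [rieszSymbol, h1, h2, fourier_lineDeriv_single, Pi.smul_apply, smul_eq_mul]
  push_cast
  ring

/-- The separately prescribed values at `β = l + 1/2` are the holomorphic continuation of the
others, so one formula covers both cases. -/
theorem laplaceH_eq_ι_kernelVec (hm : 1 ≤ m) {N : ℕ} {β : ℂ} (hN : 2 * β.re + 1 ≤ 2 * N)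
    (φ : 𝓢(Space m, ℂ)) :
    laplaceH m β φ = CliffordAlgebra.ι (negForm m) (kernelVec N β φ) := by
  by_cases h : ∀ l : ℕ, (2 * l + 1 : ℂ) - 2 * β ≠ 0
  · exact laplaceH_eq_kernelVec hm hN h φ
  · push Not at h
    obtain ⟨l, hl⟩ := h
    obtain rfl : β = l + 1 / 2 := by linear_combination -hl / 2
    have h1 : (l : ℝ) + 1 ≤ N := by
      have : ((l : ℂ) + 1 / 2).re = l + 1 / 2 := by simp
      rw [this] at hN
      linarith
    rw [laplaceH_half, dirac_iterate_odd]
    congr 1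
    ext j
    exact (kernelVec_half hm (by exact_mod_cast h1) φ j).symm

/-! ### The convolution theorem and the product of symbols -/

section Fourier

theorem fourier_comp_sub_left {V : Type*} [NormedAddCommGroup V] [NormedSpace ℂ V]
    (f : Space m → V) (x ξ : Space m) :
    (𝓕 fun y => f (x - y)) ξ = Real.fourierChar (-⟪x, ξ⟫) • (𝓕⁻ f) ξ := by
  rw [Real.fourier_eq, Real.fourierInv_eq, ← integral_sub_left_eq_self _ volume x,
    Circle.smul_def, ← integral_smul]
  refine integral_congr_ae (Eventually.of_forall fun y => ?_)
  simp only [← Circle.smul_def, sub_sub_cancel, inner_sub_left, smul_smul,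
    ← AddChar.map_add_eq_mul]
  congr 2
  ring

/-- The exchange formula `∫ M(û, g) = ∫ M(u, ĝ)` with `g = v̂(x - ·)`, whose transform is a
character times `v` by Fourier inversion at continuity points. Only `v̂` has to be integrable; `û`
need not be. -/
theorem integral_bilin_fourier_comp_sub {V W : Type*} [NormedAddCommGroup V] [NormedSpace ℂ V]
    [CompleteSpace V] [NormedAddCommGroup W] [NormedSpace ℂ W] [CompleteSpace W]
    (M : V →L[ℂ] W →L[ℂ] ℂ) {u : Space m → V} {v : Space m → W} (hu : Integrable u)
    (hv : Integrable v) (hv' : Integrable (𝓕 v)) (hc : ∀ᵐ ξ, ContinuousAt v ξ) (x : Space m) :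
    ∫ y, M ((𝓕 u) y) ((𝓕 v) (x - y)) = ∫ ξ, Real.fourierChar (-⟪x, ξ⟫) • M (u ξ) (v ξ) := by
  have h := VectorFourier.integral_bilin_fourierIntegral_eq_flip (L := innerₗ (Space m))
    (μ := volume) (ν := volume) (g := fun y => (𝓕 v) (x - y)) M Real.continuous_fourierChar
    continuous_inner hu (hv'.comp_sub_left x)
  refine h.trans (integral_congr_ae ?_)
  filter_upwards [hc] with ξ hξ
  rw [flip_innerₗ]
  have h1 := fourier_comp_sub_left (𝓕 v) x ξ
  rw [hv.fourierInv_fourier_eq hv' hξ] at h1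
  change M (u ξ) ((𝓕 fun y => (𝓕 v) (x - y)) ξ) = _
  rw [h1, Circle.smul_def, map_smul, ← Circle.smul_def]

theorem integral_schwartz_mul_comp_sub (φ ψ : 𝓢(Space m, ℂ)) (x : Space m) :
    ∫ y, φ y * ψ (x - y) =
      ∫ ξ, Real.fourierChar (-⟪x, ξ⟫) • ((𝓕⁻ φ) ξ * (𝓕⁻ ψ) ξ) := by
  have h1 : ∀ χ : 𝓢(Space m, ℂ), 𝓕 ((𝓕⁻ χ : 𝓢(Space m, ℂ)) : Space m → ℂ) = χ := fun χ => by
    rw [← SchwartzMap.fourier_coe, FourierTransform.fourier_fourierInv_eq]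
  have h := integral_bilin_fourier_comp_sub (ContinuousLinearMap.mul ℂ ℂ)
    (𝓕⁻ φ : 𝓢(Space m, ℂ)).integrable (𝓕⁻ ψ : 𝓢(Space m, ℂ)).integrable
    (by rw [h1]; exact ψ.integrable)
    (Eventually.of_forall fun ξ => (𝓕⁻ ψ : 𝓢(Space m, ℂ)).continuous.continuousAt) x
  rw [h1, h1] at h
  exact h

theorem kernelVec_reflectAt_eq_fourier (hm : 1 ≤ m) {N : ℕ} {β : ℂ} (h1 : -(m : ℝ) / 2 < β.re)
    (h2 : β.re < N) (φ : 𝓢(Space m, ℂ)) (y : Space m) :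
    kernelVec N β (reflectAt y φ) = (𝓕 fun ξ => (𝓕⁻ φ) ξ • rieszSymbol β ξ) y := by
  rw [kernelVec_eq_fourier hm h1 h2, Real.fourier_eq]
  refine integral_congr_ae (Eventually.of_forall fun ξ => ?_)
  have h3 : (reflectAt y φ : Space m → ℂ) = fun z => φ (y - z) := funext (reflectAt_apply y φ)
  simp only [SchwartzMap.fourier_coe, SchwartzMap.fourierInv_coe]
  rw [h3, fourier_comp_sub_left, smul_assoc, real_inner_comm]

theorem continuousAt_rieszSymbol (β : ℂ) {ξ : Space m} (hξ : ξ ≠ 0) :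
    ContinuousAt (rieszSymbol (m := m) β) ξ := by
  unfold rieszSymbol
  have h : ContinuousAt (fun ξ : Space m => ((‖ξ‖ : ℝ) : ℂ) ^ (2 * β - 1)) ξ :=
    ContinuousAt.cpow
      (Complex.continuous_ofReal.continuousAt.comp continuous_norm.continuousAt) continuousAt_const
      (Complex.ofReal_mem_slitPlane.2 (norm_pos_iff.2 hξ))
  exact (h.const_mul _).smul continuous_cvec.continuousAt

/-- `(-i)² = -1` meets `ξ² = -|ξ|²` in the Clifford algebra, and the powers of `2π` and `|ξ|` cancel
the rest. This is the algebraic core of the inversion. -/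
theorem ι_rieszSymbol_mul (β : ℂ) {ξ : Space m} (hξ : ξ ≠ 0) :
    CliffordAlgebra.ι (negForm m) (rieszSymbol β ξ) *
      CliffordAlgebra.ι (negForm m) (rieszSymbol (-β) ξ) = 1 := by
  have hn : ((‖ξ‖ : ℝ) : ℂ) ≠ 0 := by exact_mod_cast norm_ne_zero_iff.2 hξ
  have hp : ((2 * Real.pi : ℝ) : ℂ) ≠ 0 := by exact_mod_cast Real.two_pi_pos.ne'
  have h1 : ((‖ξ‖ : ℝ) : ℂ) ^ 2 = ∑ j, cvec ξ j * cvec ξ j := by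
    rw [← Complex.ofReal_pow, EuclideanSpace.real_norm_sq_eq, Complex.ofReal_sum]
    exact Finset.sum_congr rfl fun j _ => by rw [Complex.ofReal_pow, sq]; rfl
  have h2 : ((2 * Real.pi : ℝ) : ℂ) ^ (2 * β) * ((2 * Real.pi : ℝ) : ℂ) ^ (2 * -β) = 1 := by
    rw [← Complex.cpow_add _ _ hp]
    simp
  have h3 : ((‖ξ‖ : ℝ) : ℂ) ^ (2 * β - 1) * ((‖ξ‖ : ℝ) : ℂ) ^ (2 * -β - 1) =
      (((‖ξ‖ : ℝ) : ℂ) ^ 2)⁻¹ := by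
    rw [← Complex.cpow_add _ _ hn, show 2 * β - 1 + (2 * -β - 1) = -((2 : ℕ) : ℂ) by push_cast; ring,
      Complex.cpow_neg, Complex.cpow_natCast]
  rw [rieszSymbol, rieszSymbol, map_smul, map_smul, smul_mul_smul_comm, ι_mul_self, ← h1,
    Algebra.algebraMap_eq_smul_one, smul_smul]
  convert one_smul ℂ _
  calc _ = -Complex.I ^ 2 * (((2 * Real.pi : ℝ) : ℂ) ^ (2 * β) * ((2 * Real.pi : ℝ) : ℂ) ^ (2 * -β)) *
        (((‖ξ‖ : ℝ) : ℂ) ^ (2 * β - 1) * ((‖ξ‖ : ℝ) : ℂ) ^ (2 * -β - 1)) * ((‖ξ‖ : ℝ) : ℂ) ^ 2 := by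
        ring
    _ = 1 := by
        rw [h2, h3, Complex.I_sq]
        field_simp

end Fourier

/-! ### The composition identity on a strip -/

/-- The bilinear form `(v, w) ↦ ℓ (v w)` on Clifford vectors. -/
def vecMul (ℓ : Module.Dual ℂ (Cl m)) : (Fin m → ℂ) →L[ℂ] (Fin m → ℂ) →L[ℂ] ℂ :=
  LinearMap.toContinuousBilinearMap
    (((LinearMap.mul ℂ (Cl m)).compl₁₂ (CliffordAlgebra.ι (negForm m))
      (CliffordAlgebra.ι (negForm m))).compr₂ ℓ)

theorem vecMul_apply (ℓ : Module.Dual ℂ (Cl m)) (v w : Fin m → ℂ) :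
    vecMul ℓ v w =
      ℓ (CliffordAlgebra.ι (negForm m) v * CliffordAlgebra.ι (negForm m) w) := rfl

/-- The composition identity in the range where both kernels have locally integrable symbols and
one of the two regularized kernels is integrable. -/
theorem integral_vecMul_kernelVec_aux (hm : 1 ≤ m) {N : ℕ} {β : ℂ} (h1 : -(m : ℝ) / 2 < β.re)
    (h2 : β.re < 0) (hN : 2 * -β.re + 1 < 2 * N) (ℓ : Module.Dual ℂ (Cl m)) (φ ψ : 𝓢(Space m, ℂ))
    (x : Space m) :
    ∫ y, vecMul ℓ (kernelVec N β (reflectAt y φ)) (kernelVec N (-β) (reflectAt (x - y) ψ)) =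
      (∫ y, φ y * ψ (x - y)) * ℓ 1 := by
  have h3 : -(m : ℝ) / 2 < (-β).re := by
    rw [Complex.neg_re]
    linarith [Nat.cast_nonneg (α := ℝ) m]
  have h4 : (-β).re < N := by rw [Complex.neg_re]; linarith
  have h5 : β.re < N := by linarith
  have hu := integrable_smul_rieszSymbol hm h1 (𝓕⁻ φ)
  have hv := integrable_smul_rieszSymbol hm h3 (𝓕⁻ ψ)
  have hK : (𝓕 fun ξ => (𝓕⁻ ψ) ξ • rieszSymbol (-β) ξ) =
      fun y => kernelVec N (-β) (reflectAt y ψ) :=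
    funext fun y => (kernelVec_reflectAt_eq_fourier hm h3 h4 ψ y).symm
  have hv' : Integrable (𝓕 fun ξ => (𝓕⁻ ψ) ξ • rieszSymbol (-β) ξ) := by
    rw [hK]
    -- The exponent `-m + Re β` lies strictly between the decay rate `-m + 2 Re β` of the kernel for
    -- `-β` and the integrability threshold `-m`.
    obtain ⟨C, hC, hb⟩ := exists_norm_kernelVec_le_rpow (N := N) (β₀ := -β)
      (by rw [Complex.neg_re]; linarith) (ne_neg_of_re_gt h3) ψ (p := -((m : ℝ) + -β.re))
      (by rw [Complex.neg_re]; linarith)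
    have hi : Integrable fun y : Space m => (1 + ‖y‖) ^ (-((m : ℝ) + -β.re)) :=
      integrable_one_add_norm (by rw [finrank_euclideanSpace_fin]; linarith)
    exact (hi.const_mul C).mono'
      (stronglyMeasurable_kernelVec_reflectAt N (-β) ψ).aestronglyMeasurable
      (Eventually.of_forall hb.self_of_nhds)
  have hne : ∀ᵐ z : Space m, z ≠ 0 := by
    have := nontrivial_space hm
    simp [ae_iff]
  have hc : ∀ᵐ ξ : Space m, ContinuousAt (fun ξ => (𝓕⁻ ψ) ξ • rieszSymbol (-β) ξ) ξ := by
    filter_upwards [hne] with ξ hξ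
    exact (𝓕⁻ ψ : 𝓢(Space m, ℂ)).continuous.continuousAt.smul (continuousAt_rieszSymbol _ hξ)
  have h := integral_bilin_fourier_comp_sub (vecMul ℓ) hu hv hv' hc x
  simp_rw [kernelVec_reflectAt_eq_fourier hm h1 h5, kernelVec_reflectAt_eq_fourier hm h3 h4]
  rw [h, integral_schwartz_mul_comp_sub, ← integral_mul_const]
  refine integral_congr_ae ?_
  filter_upwards [hne] with ξ hξ
  rw [vecMul_apply, map_smul, map_smul, smul_mul_smul_comm, ι_rieszSymbol_mul β hξ, map_smul,
    smul_mul_assoc, smul_eq_mul]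

/-! ### Analytic continuation in the parameter -/

section Continuation

theorem one_add_norm_sub_rpow_le (q : ℝ) (x y : Space m) :
    (1 + ‖x - y‖) ^ q ≤ (1 + ‖x‖) ^ |q| * (1 + ‖y‖) ^ q := by
  have hx : 0 < 1 + ‖x‖ := by positivity
  have hy : 0 < 1 + ‖y‖ := by positivity
  have hw : 0 < 1 + ‖x - y‖ := by positivity
  rcases le_total 0 q with hq | hq
  · rw [abs_of_nonneg hq, ← Real.mul_rpow hx.le hy.le]
    refine Real.rpow_le_rpow hw.le ?_ hq
    nlinarith [norm_sub_le x y, norm_nonneg x, norm_nonneg y]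
  · rw [abs_of_nonpos hq, Real.rpow_neg hx.le, ← div_eq_inv_mul, ← Real.div_rpow hy.le hx.le]
    refine Real.rpow_le_rpow_of_nonpos (by positivity) ?_ hq
    rw [div_le_iff₀ hx, mul_comm]
    exact one_add_norm_le_mul' x y

/-- The decay rates `-2 Re β - m` and `2 Re β - m` sum to `-2m`. A slack of `1/4` in each gives `-2m
+ 1/2 < -m` because `m ≥ 1`, so the product is integrable for every regular `β`. -/
theorem exists_integrable_bound (hm : 1 ≤ m) {N : ℕ} {β₀ : ℂ} (hN : 2 * |β₀.re| + 1 < 2 * N)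
    (hpos : ∀ n : ℕ, β₀ ≠ ((m : ℂ) + 1) / 2 + n) (hneg : ∀ n : ℕ, β₀ ≠ -(((m : ℂ) + 1) / 2 + n))
    (ℓ : Module.Dual ℂ (Cl m)) (φ ψ : 𝓢(Space m, ℂ)) (x : Space m) :
    ∃ g : Space m → ℝ, Integrable g ∧ ∀ᶠ β in 𝓝 β₀, ∀ y,
      ‖vecMul ℓ (kernelVec N β (reflectAt y φ)) (kernelVec N (-β) (reflectAt (x - y) ψ))‖ ≤ g y := by
  have hm' : (1 : ℝ) ≤ m := by exact_mod_cast hm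
  obtain ⟨C₁, hC₁, h₁⟩ := exists_norm_kernelVec_le_rpow (N := N) (β₀ := β₀)
    (by linarith [le_abs_self β₀.re]) hneg φ (p := -2 * β₀.re - m + 1 / 4) (by linarith)
  obtain ⟨C₂, hC₂, h₂⟩ := exists_norm_kernelVec_le_rpow (N := N) (β₀ := -β₀)
    (by rw [Complex.neg_re]; linarith [neg_abs_le β₀.re]) (fun n h => hpos n (neg_injective h)) ψ
    (p := 2 * β₀.re - m + 1 / 4) (by rw [Complex.neg_re]; linarith)
  have h₂' := (continuous_neg.tendsto β₀).eventually h₂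
  refine ⟨fun y => ‖vecMul ℓ‖ * C₁ * C₂ * (1 + ‖x‖) ^ |2 * β₀.re - m + 1 / 4| *
    (1 + ‖y‖) ^ (-(2 * (m : ℝ) - 1 / 2)), ?_, ?_⟩
  · exact (integrable_one_add_norm (by rw [finrank_euclideanSpace_fin]; linarith)).const_mul _
  · filter_upwards [h₁, h₂'] with β hb₁ hb₂ y
    have hy : 0 < 1 + ‖y‖ := by positivity
    have he : -(2 * (m : ℝ) - 1 / 2) = (-2 * β₀.re - m + 1 / 4) + (2 * β₀.re - m + 1 / 4) := by ring
    rw [he, Real.rpow_add hy]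
    calc _ ≤ ‖vecMul ℓ‖ * ‖kernelVec N β (reflectAt y φ)‖ *
          ‖kernelVec N (-β) (reflectAt (x - y) ψ)‖ := (vecMul ℓ).le_opNorm₂ _ _
      _ ≤ ‖vecMul ℓ‖ * (C₁ * (1 + ‖y‖) ^ (-2 * β₀.re - m + 1 / 4)) *
          (C₂ * ((1 + ‖x‖) ^ |2 * β₀.re - m + 1 / 4| * (1 + ‖y‖) ^ (2 * β₀.re - m + 1 / 4))) := by
          gcongr
          · exact hb₁ y
          · refine (hb₂ (x - y)).trans ?_
            gcongr
            exact one_add_norm_sub_rpow_le _ x y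
      _ = _ := by ring

theorem aestronglyMeasurable_vecMul_kernelVec (N : ℕ) (β : ℂ) (ℓ : Module.Dual ℂ (Cl m))
    (φ ψ : 𝓢(Space m, ℂ)) (x : Space m) :
    AEStronglyMeasurable (fun y => vecMul ℓ (kernelVec N β (reflectAt y φ))
      (kernelVec N (-β) (reflectAt (x - y) ψ))) volume := by
  have h1 := stronglyMeasurable_kernelVec_reflectAt N β φ
  have h2 := (stronglyMeasurable_kernelVec_reflectAt N (-β) ψ).comp_measurable
    (measurable_const.sub measurable_id : Measurable fun y : Space m => x - y)
  exact ((vecMul ℓ).continuous₂.comp_stronglyMeasurable (h1.prodMk h2)).aestronglyMeasurable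

theorem integrable_vecMul_kernelVec (hm : 1 ≤ m) {N : ℕ} {β : ℂ} (hN : 2 * |β.re| + 1 < 2 * N)
    (hpos : ∀ n : ℕ, β ≠ ((m : ℂ) + 1) / 2 + n) (hneg : ∀ n : ℕ, β ≠ -(((m : ℂ) + 1) / 2 + n))
    (ℓ : Module.Dual ℂ (Cl m)) (φ ψ : 𝓢(Space m, ℂ)) (x : Space m) :
    Integrable fun y => vecMul ℓ (kernelVec N β (reflectAt y φ))
      (kernelVec N (-β) (reflectAt (x - y) ψ)) := by
  obtain ⟨g, hg, h⟩ := exists_integrable_bound hm hN hpos hneg ℓ φ ψ x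
  exact hg.mono' (aestronglyMeasurable_vecMul_kernelVec N β ℓ φ ψ x)
    (Eventually.of_forall h.self_of_nhds)

/-- The parameters at which neither of the kernels of `(-Δ)^β H` and `(-Δ)^{-β} H` has a pole. -/
def regularSet (m : ℕ) : Set ℂ :=
  {β | (∀ n : ℕ, β ≠ ((m : ℂ) + 1) / 2 + n) ∧ ∀ n : ℕ, β ≠ -(((m : ℂ) + 1) / 2 + n)}

theorem compl_regularSet : (regularSet m)ᶜ = range (fun n : ℕ => ((m : ℂ) + 1) / 2 + n) ∪
    range (fun n : ℕ => -(((m : ℂ) + 1) / 2 + n)) := by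
  ext β
  simp only [regularSet, mem_compl_iff, mem_ofPred_eq, mem_union, mem_range]
  push Not
  grind

theorem isOpen_regularSet : IsOpen (regularSet m) := by
  have h : Topology.IsClosedEmbedding (fun n : ℕ => (n : ℂ)) := by
    have := Complex.isometry_ofReal.isClosedEmbedding.comp Nat.isClosedEmbedding_coe_real
    exact this
  have h1 : Topology.IsClosedEmbedding (fun n : ℕ => ((m : ℂ) + 1) / 2 + n) :=
    (Homeomorph.addLeft (((m : ℂ) + 1) / 2)).isClosedEmbedding.comp h
  have h2 : Topology.IsClosedEmbedding (fun n : ℕ => -(((m : ℂ) + 1) / 2 + n)) :=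
    (Homeomorph.neg ℂ).isClosedEmbedding.comp h1
  rw [← isClosed_compl_iff, compl_regularSet]
  exact h1.isClosed_range.union h2.isClosed_range

/-- Removing a countable set from the plane leaves it connected. -/
theorem isPreconnected_regularSet : IsPreconnected (regularSet m) := by
  have h : ((regularSet m)ᶜ).Countable := by
    rw [compl_regularSet]
    exact (countable_range _).union (countable_range _)
  have := (h.isConnected_compl_of_one_lt_rank (by rw [Complex.rank_real_complex]; norm_num)).isPreconnected
  rwa [compl_compl] at this

theorem regularize_laplaceH (hm : 1 ≤ m) {N : ℕ} {β : ℂ} (hN : 2 * β.re + 1 ≤ 2 * N)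
    (φ : 𝓢(Space m, ℂ)) (y : Space m) :
    regularize (laplaceH m β) φ y =
      CliffordAlgebra.ι (negForm m) (kernelVec N β (reflectAt y φ)) :=
  laplaceH_eq_ι_kernelVec hm hN _

theorem regularize_mul_regularize (hm : 1 ≤ m) {N : ℕ} {β : ℂ} (hN : 2 * |β.re| + 1 ≤ 2 * N)
    (ℓ : Module.Dual ℂ (Cl m)) (φ ψ : 𝓢(Space m, ℂ)) (x y : Space m) :
    ℓ (regularize (laplaceH m β) φ y * regularize (laplaceH m (-β)) ψ (x - y)) =
      vecMul ℓ (kernelVec N β (reflectAt y φ)) (kernelVec N (-β) (reflectAt (x - y) ψ)) := by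
  rw [regularize_laplaceH hm (N := N) (by linarith [le_abs_self β.re]),
    regularize_laplaceH hm (N := N) (by rw [Complex.neg_re]; linarith [neg_abs_le β.re]),
    vecMul_apply]

/-- The truncation order `N` can only be fixed locally. Stating the integral through `laplaceH`
makes it a single function on all of `regularSet m`. -/
theorem differentiableAt_integral_regularize (hm : 1 ≤ m) {β₀ : ℂ} (h : β₀ ∈ regularSet m)
    (ℓ : Module.Dual ℂ (Cl m)) (φ ψ : 𝓢(Space m, ℂ)) (x : Space m) :
    DifferentiableAt ℂ (fun β => ∫ y,
      ℓ (regularize (laplaceH m β) φ y * regularize (laplaceH m (-β)) ψ (x - y))) β₀ := by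
  obtain ⟨N, hN⟩ := exists_nat_gt (|β₀.re| + 1 / 2)
  have hlt : ∀ᶠ β : ℂ in 𝓝 β₀, 2 * |β.re| + 1 < 2 * N := by
    have hc : Continuous fun β : ℂ => 2 * |β.re| + 1 := by fun_prop
    exact hc.continuousAt.eventually_lt continuousAt_const (by linarith)
  obtain ⟨g, hg, hb⟩ := exists_integrable_bound hm (N := N) (by linarith) h.1 h.2 ℓ φ ψ x
  obtain ⟨ε, hε, hball⟩ := Metric.eventually_nhds_iff_ball.1
    (hlt.and (hb.and (isOpen_regularSet.mem_nhds h)))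
  refine differentiableAt_integral_of_norm_le hε (fun β hβ => ?_)
    (Eventually.of_forall fun y β hβ => ?_) (Eventually.of_forall fun y β hβ => ?_) hg
  · simp_rw [regularize_mul_regularize hm (hball β hβ).1.le]
    exact aestronglyMeasurable_vecMul_kernelVec N β ℓ φ ψ x
  · obtain ⟨h1, -, h2, h3⟩ := hball β hβ
    have he : (fun β => ℓ (regularize (laplaceH m β) φ y * regularize (laplaceH m (-β)) ψ (x - y)))
        =ᶠ[𝓝 β] fun β => vecMul ℓ (kernelVec N β (reflectAt y φ))
          (kernelVec N (-β) (reflectAt (x - y) ψ)) := by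
      filter_upwards [Metric.isOpen_ball.mem_nhds hβ] with z hz
      exact regularize_mul_regularize hm (hball z hz).1.le ℓ φ ψ x y
    refine DifferentiableAt.congr_of_eventuallyEq ?_ he
    have d1 : DifferentiableAt ℂ (fun β => kernelVec N β (reflectAt y φ)) β :=
      differentiableAt_kernelVec (by linarith [le_abs_self β.re]) h3 _
    have d2 : DifferentiableAt ℂ (fun β => kernelVec N (-β) (reflectAt (x - y) ψ)) β := by
      have d3 := differentiableAt_kernelVec (N := N) (β := -β)
        (by rw [Complex.neg_re]; linarith [neg_abs_le β.re]) (fun n h => h2 n (neg_injective h))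
        (reflectAt (x - y) ψ)
      exact DifferentiableAt.comp (g := fun β => kernelVec N β (reflectAt (x - y) ψ)) β d3
        differentiableAt_id.neg
    exact ((vecMul ℓ).differentiableAt.comp β d1).clm_apply d2
  · obtain ⟨h1, h2, -⟩ := hball β hβ
    rw [regularize_mul_regularize hm h1.le]
    exact h2 y

/-- The right side does not depend on `β`; the identity known on a strip spreads over the connected
set by the identity theorem. -/
theorem integral_regularize_mul_regularize (hm : 1 ≤ m) {β : ℂ} (h : β ∈ regularSet m)
    (ℓ : Module.Dual ℂ (Cl m)) (φ ψ : 𝓢(Space m, ℂ)) (x : Space m) :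
    ∫ y, ℓ (regularize (laplaceH m β) φ y * regularize (laplaceH m (-β)) ψ (x - y)) =
      (∫ y, φ y * ψ (x - y)) * ℓ 1 := by
  have hm' : (1 : ℝ) ≤ m := by exact_mod_cast hm
  have hf : AnalyticOnNhd ℂ (fun β => ∫ y,
      ℓ (regularize (laplaceH m β) φ y * regularize (laplaceH m (-β)) ψ (x - y))) (regularSet m) :=
    DifferentiableOn.analyticOnNhd (fun z hz =>
      (differentiableAt_integral_regularize hm hz ℓ φ ψ x).differentiableWithinAt) isOpen_regularSet
  set W : Set ℂ := {z | -1 / 2 < z.re} ∩ {z | z.re < 0}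
  have hWo : IsOpen W := (isOpen_lt continuous_const Complex.continuous_re).inter
    (isOpen_lt Complex.continuous_re continuous_const)
  have hre : (((-1 / 4 : ℝ) : ℂ)).re = -1 / 4 := Complex.ofReal_re _
  have hz₀ : ((-1 / 4 : ℝ) : ℂ) ∈ W := by
    constructor
    · change _ < (((-1 / 4 : ℝ) : ℂ)).re
      rw [hre]; norm_num
    · change (((-1 / 4 : ℝ) : ℂ)).re < _
      rw [hre]; norm_num
  have hmem : ((-1 / 4 : ℝ) : ℂ) ∈ regularSet m := by
    refine ⟨fun n h0 => ne_neg_of_re_gt (m := m) (β := -((-1 / 4 : ℝ) : ℂ)) ?_ n (by rw [h0]),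
      ne_neg_of_re_gt ?_⟩
    · rw [Complex.neg_re, hre]; linarith
    · rw [hre]; linarith
  refine hf.eqOn_of_preconnected_of_eventuallyEq (analyticOnNhd_const) isPreconnected_regularSet
    hmem ?_ h
  filter_upwards [hWo.mem_nhds hz₀] with z hz
  have hz1 : -1 / 2 < z.re := hz.1
  have hz2 : z.re < 0 := hz.2
  have habs : |z.re| = -z.re := abs_of_neg hz2
  rw [← integral_vecMul_kernelVec_aux hm (N := 2) (by linarith) hz2 (by push_cast; linarith) ℓ φ ψ x]
  exact integral_congr_ae (Eventually.of_forall fun y => regularize_mul_regularize hm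
    (by rw [habs]; push_cast; linarith) ℓ φ ψ x y)

end Continuation

/-! ### Temperedness and the convolution identity -/

theorem isTempered_laplaceH (hm : 1 ≤ m) (β : ℂ) : IsTempered (laplaceH m β) := by
  obtain ⟨N, hN⟩ := exists_nat_gt (β.re + 1 / 2)
  exact isTempered_of_eq_ι_kernelVec (N := N) (by linarith)
    (laplaceH_eq_ι_kernelVec hm (by linarith))

theorem isTempered_delta (m : ℕ) : IsTempered (delta m) where
  linear := ⟨fun φ ψ => by simp [delta], fun c φ => by simp [delta, Algebra.smul_def]⟩
  continuous ℓ := by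
    have h : ∀ φ : 𝓢(Space m, ℂ), ℓ (delta m φ) = φ 0 * ℓ 1 := fun φ => by
      rw [delta, Algebra.algebraMap_eq_smul_one, map_smul, smul_eq_mul]
    simp_rw [h]
    refine Continuous.mul ?_ continuous_const
    exact (BoundedContinuousFunction.evalCLM ℂ (0 : Space m)).continuous.comp
      (SchwartzMap.toBoundedContinuousFunctionCLM ℂ (Space m) ℂ).continuous

theorem isConvolution_laplaceH (hm : 1 ≤ m) {β : ℂ} (h : β ∈ regularSet m) :
    IsConvolution (laplaceH m β) (laplaceH m (-β)) (delta m) where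
  left_tempered := isTempered_laplaceH hm β
  right_tempered := isTempered_laplaceH hm (-β)
  result_tempered := isTempered_delta m
  integrable φ ψ x ℓ := by
    obtain ⟨N, hN⟩ := exists_nat_gt (|β.re| + 1 / 2)
    simp_rw [regularize_mul_regularize hm (N := N) (show 2 * |β.re| + 1 ≤ 2 * N by linarith)]
    exact integrable_vecMul_kernelVec hm (by linarith) h.1 h.2 ℓ φ ψ x
  integral_eq φ ψ x ℓ := by
    rw [integral_regularize_mul_regularize hm h, ← integral_mul_const]
    refine integral_congr_ae (Eventually.of_forall fun y => ?_)
    simp only [regularize, delta, reflectAt_apply, sub_zero, Algebra.algebraMap_eq_smul_one,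
      map_smul, smul_eq_mul]
    ring

end CliffordPotentials

end

theorem corollary7p1 (m : ℕ) (hm : 1 ≤ m) (β : ℂ)
    (hpos : ∀ n : ℕ, β ≠ ((m : ℂ) + 1) / 2 + n)
    (hneg : ∀ n : ℕ, β ≠ -(((m : ℂ) + 1) / 2 + n)) :
    CliffordPotentials.IsConvolution (CliffordPotentials.laplaceH m β)
        (CliffordPotentials.laplaceH m (-β)) (CliffordPotentials.delta m) ∧
      CliffordPotentials.IsFundamentalSolutionL m β (CliffordPotentials.L m β) :=
  ⟨CliffordPotentials.isConvolution_laplaceH hm ⟨hpos, hneg⟩,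
    CliffordPotentials.isConvolution_laplaceH hm ⟨hpos, hneg⟩⟩
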